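/- Let $\mathcal H$ be a complex Hilbert space and $N\in\mathbb N$. An $N$-partite system on $\mathcal H$ is a tuple $(\mathcal M_x)_{x\in[N]}$ of pairwise commuting von Neumann algebras on $\mathcal H$, where $[N]=\{1,\dots,N\}$; put $\mathcal M_{[N]}=\bigvee_{x}\mathcal M_x$. A normal state $\omega$ on $\mathcal M_{[N]}$ is called $N$-partite embezzling if for all $d\in\mathbb N$, all pure states $\psi,\phi$ on $M_d(\mathbb C)^{\otimes N}$ (i.e. vector states of unit vectors of $(\mathbb C^d)^{\otimes N}$) and all $\varepsilon>0$ there are unitaries $u_x\in\mathcal M_x\otimes M_d(\mathbb C)$, $x\in[N]$, with $$\|u(\omega\otimes\phi)u^*-\omega\otimes\psi\|<\varepsilon,\qquad u=\prod_{x}u_x ,$$ where $u_x$ acts on the $x$-th tensor factor of $(\mathbb C^d)^{\otimes N}$, $(ufu^*)(a)=f(u^*au)$, and the norm is that of functionals on $\mathcal M_{[N]}\otimes M_d(\mathbb C)^{\otimes N}$. **Theorem.** Let $(\mathcal M_x)_{x\in[N]}$ be an $N$-partite system on $\mathcal H$ generated by an increasing net of subsystems: that is, $(\mathcal M^{(n)}_x)_{x\in[N]}$,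 $n\in I$, are $N$-partite systems on $\mathcal H$ indexed by a non-empty directed set $I$, with $\mathcal M_x^{(n)}\subset\mathcal M_x^{(m)}$ for $n\le m$ and $\mathcal M_x=\bigvee_n\mathcal M_x^{(n)}$ for all $x$. Let $\omega$ be an $N$-partite embezzling state on $(\mathcal M_x)_{x\in[N]}$ and let $\omega^{(n)}$ be its restriction to $\mathcal M^{(n)}_{[N]}=\bigvee_x\mathcal M_x^{(n)}$. Then $(\omega^{(n)})_n$ is a consistent $N$-partite embezzling family, that is: 1. (embezzling family) for all $d\in\mathbb N$ and $\varepsilon>0$ there is $n=n(d,\varepsilon)$ such that for all $m\ge n$ and all pure states $\psi,\phi$ on $M_d(\mathbb C)^{\otimes N}$ there are unitaries $u_x^{(m)}\in\mathcal M_x^{(m)}\otimes M_d(\mathbb C)$ with $\|u^{(m)}(\omega^{(m)}\otimes\phi)(u^{(m)})^*-\omega^{(m)}\otimes\psi\|<\varepsilon$, where $u^{(m)}=\prod_xu_x^{(m)}$; 2. (quasi-consistency) for all $d\in\mathbb N$ and $\varepsilon>0$ there is $n=n(d,\varepsilon)$ such that for all pure states $\psi,\phi$ on $M_d(\mathbb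 C)^{\otimes N}$ there are unitaries $u_x^{(n)}\in\mathcal M_x^{(n)}\otimes M_d(\mathbb C)$ such that, with $u^{(n)}=\prod_xu_x^{(n)}$, for all $m\ge n$ one has $\|u^{(n)}(\omega^{(m)}\otimes\phi)(u^{(n)})^*-\omega^{(m)}\otimes\psi\|<\varepsilon$; 3. (consistency of the states) $\omega^{(n)}=\omega^{(m)}\restriction\mathcal M^{(n)}_{[N]}$ for all $n\le m$. -/

import Mathlib

open scoped ENNReal ComplexOrder

namespace Embezzlement

section vonNeumann

variable {H : Type*} [NormedAddCommGroup H] [InnerProductSpace ℂ H] [CompleteSpace H]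

/-- The von Neumann algebra generated by a family of von Neumann algebras on `H`:
the double commutant of their union. -/
noncomputable def join {κ : Type*} (M : κ → VonNeumannAlgebra H) : VonNeumannAlgebra H where
  toStarSubalgebra :=
    StarSubalgebra.centralizer ℂ
      (StarSubalgebra.centralizer ℂ (⋃ k, (M k : Set (H →L[ℂ] H))) : Set (H →L[ℂ] H))
  centralizer_centralizer' := by simp

theorem mem_join_iff {κ : Type*} (M : κ → VonNeumannAlgebra H) (a : H →L[ℂ] H) :
    a ∈ join M ↔
      a ∈ Set.centralizer (Set.centralizer (⋃ k, (M k : Set (H →L[ℂ] H)))) := by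
  have hstar : star (⋃ k, (M k : Set (H →L[ℂ] H))) = ⋃ k, (M k : Set (H →L[ℂ] H)) := by
    ext b
    simp
  change a ∈ StarSubalgebra.centralizer ℂ _ ↔ _
  rw [← SetLike.mem_coe, StarSubalgebra.coe_centralizer_centralizer, hstar, Set.union_self]

theorem le_join {κ : Type*} (M : κ → VonNeumannAlgebra H) (k : κ) : M k ≤ join M :=
  fun a ha => (mem_join_iff M a).2
    (Set.subset_centralizer_centralizer (Set.mem_iUnion.2 ⟨k, ha⟩))

theorem join_mono {κ : Type*} {M M' : κ → VonNeumannAlgebra H} (h : ∀ k, M k ≤ M' k) :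
    join M ≤ join M' := fun a ha => (mem_join_iff M' a).2
  (Set.centralizer_subset (Set.centralizer_subset (Set.iUnion_mono fun k => h k))
    ((mem_join_iff M a).1 ha))

/-- The inclusion of a von Neumann algebra in a larger one on the same Hilbert space. -/
noncomputable def incl {A B : VonNeumannAlgebra H} (h : A ≤ B) :
    A.toStarSubalgebra →⋆ₐ[ℂ] B.toStarSubalgebra :=
  StarSubalgebra.inclusion (fun _ ha => h ha)

variable (H) in
/-- The ultraweak topology on `B(H)`: the coarsest topology for which all functionals
`a ↦ ∑ₖ ⟨ξₖ, a ηₖ⟩` with `∑ₖ ‖ξₖ‖² < ∞` and `∑ₖ ‖ηₖ‖² < ∞` are continuous. -/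
@[reducible] noncomputable def ultraweakTopology : TopologicalSpace (H →L[ℂ] H) :=
  ⨅ (ξ : ℕ → H) (η : ℕ → H) (_ : Summable fun k => ‖ξ k‖ ^ 2)
    (_ : Summable fun k => ‖η k‖ ^ 2),
    TopologicalSpace.induced (fun a => ∑' k, inner ℂ (ξ k) (a (η k))) inferInstance

/-- The ultraweak topology on a von Neumann algebra on `H`. -/
@[reducible] noncomputable def ultraweakOn (M : VonNeumannAlgebra H) : TopologicalSpace M.toStarSubalgebra :=
  (ultraweakTopology H).induced Subtype.val

/-- A normal state on a von Neumann algebra: an ultraweakly continuous positive linear functional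
with value `1` at the unit. -/
structure NormalState (M : VonNeumannAlgebra H) where
  /-- the underlying linear functional -/
  functional : M.toStarSubalgebra →ₗ[ℂ] ℂ
  nonneg : ∀ a, 0 ≤ functional (star a * a)
  map_one : functional 1 = 1
  normal : @Continuous _ _ (ultraweakOn M) _ functional

/-- The restriction of a normal state to a von Neumann subalgebra. -/
noncomputable def NormalState.restrict {A B : VonNeumannAlgebra H} (h : A ≤ B) (ω : NormalState B) :
    NormalState A where
  functional := ω.functional ∘ₗ (incl h).toLinearMap
  nonneg a := by
    have := ω.nonneg (incl h a)
    rwa [← map_star, ← map_mul] at this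
  map_one := by
    change ω.functional (incl h 1) = 1
    rw [_root_.map_one, ω.map_one]
  normal := by
    have hc : @Continuous _ _ (ultraweakOn A) (ultraweakOn B) (incl h) := by
      unfold ultraweakOn
      rw [continuous_induced_rng]
      exact continuous_induced_dom
    exact @Continuous.comp _ _ _ (ultraweakOn A) (ultraweakOn B) _ _ _ ω.normal hc

/-! ### The algebras `M ⊗ M_κ(ℂ)`, realised as the matrices over `M` indexed by `κ` -/

/-- The norm of the von Neumann algebra `M ⊗ M_κ(ℂ)`. -/
noncomputable def matNorm {M : VonNeumannAlgebra H} {κ : Type*} [Fintype κ]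
    (a : Matrix κ κ M.toStarSubalgebra) : ℝ :=
  ‖CStarMatrix.ofMatrix (a.map (fun b => (b : H →L[ℂ] H)))‖

/-- The norm of a linear functional on `M ⊗ M_κ(ℂ)`, as a functional on a normed space. -/
noncomputable def functionalNorm {M : VonNeumannAlgebra H} {κ : Type*} [Fintype κ]
    (f : Matrix κ κ M.toStarSubalgebra →ₗ[ℂ] ℂ) : ℝ≥0∞ :=
  ⨆ (a : Matrix κ κ M.toStarSubalgebra) (_ : matNorm a ≤ 1), ‖f a‖ₑ

/-- The functional `ω ⊗ ⟨φ| · |φ⟩` on `M ⊗ M_κ(ℂ)`, for a vector `φ` of `ℂ^κ`. -/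
noncomputable def tensorVectorState {M : VonNeumannAlgebra H} {κ : Type*} [Fintype κ]
    (ω : NormalState M) (φ : EuclideanSpace ℂ κ) : Matrix κ κ M.toStarSubalgebra →ₗ[ℂ] ℂ where
  toFun a := ∑ i, ∑ j, star (φ i) * ω.functional (a i j) * φ j
  map_add' a b := by
    simp [mul_add, add_mul, Finset.sum_add_distrib]
  map_smul' c a := by
    simp only [Matrix.smul_apply, map_smul, smul_eq_mul, RingHom.id_apply, Finset.mul_sum]
    refine Finset.sum_congr rfl fun i _ => Finset.sum_congr rfl fun j _ => ?_
    ring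

/-- The functional `u f u*`, that is, `a ↦ f (u* a u)`. -/
noncomputable def conjFunctional {M : VonNeumannAlgebra H} {κ : Type*} [Fintype κ] [DecidableEq κ]
    (u : Matrix κ κ M.toStarSubalgebra) (f : Matrix κ κ M.toStarSubalgebra →ₗ[ℂ] ℂ) :
    Matrix κ κ M.toStarSubalgebra →ₗ[ℂ] ℂ :=
  f ∘ₗ LinearMap.mulLeft ℂ (star u) ∘ₗ LinearMap.mulRight ℂ u

end vonNeumann

/-- An element of `R ⊗ M_d(ℂ)` regarded as an element of `R ⊗ M_d(ℂ)^{⊗N}` that acts on the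
tensor factor `x`. The product basis of `(ℂ^d)^{⊗N}` is indexed by `Fin N → Fin d`. -/
def atParty {R : Type*} [Zero R] {N d : ℕ} (x : Fin N) (u : Matrix (Fin d) (Fin d) R) :
    Matrix (Fin N → Fin d) (Fin N → Fin d) R :=
  Matrix.of fun i j => if ∀ y, y ≠ x → i y = j y then u (i x) (j x) else 0

/-- An `N`-partite system on the Hilbert space `H`: pairwise commuting von Neumann algebras. -/
structure NPartiteSystem (N : ℕ) (H : Type*) [NormedAddCommGroup H] [InnerProductSpace ℂ H]
    [CompleteSpace H] where
  /-- the algebra of the party `x` -/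
  party : Fin N → VonNeumannAlgebra H
  commute : ∀ x y, x ≠ y → ∀ a ∈ party x, ∀ b ∈ party y, Commute a b

namespace NPartiteSystem

variable {N : ℕ} {H : Type*} [NormedAddCommGroup H] [InnerProductSpace ℂ H] [CompleteSpace H]

/-- The joint algebra, generated by the algebras of all parties. -/
noncomputable def joint (S : NPartiteSystem N H) : VonNeumannAlgebra H := join S.party

theorem party_le_joint (S : NPartiteSystem N H) (x : Fin N) : S.party x ≤ S.joint :=
  le_join S.party x

theorem joint_mono {S T : NPartiteSystem N H} (h : ∀ x, S.party x ≤ T.party x) :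
    S.joint ≤ T.joint := join_mono h

/-- A choice of one element of `Mₓ ⊗ M_d(ℂ)` for every party `x`. -/
abbrev LocalFamily (S : NPartiteSystem N H) (d : ℕ) : Type _ :=
  (x : Fin N) → Matrix (Fin d) (Fin d) (S.party x).toStarSubalgebra

/-- The product `∏ₓ uₓ` in the joint algebra tensored with `M_d(ℂ)^{⊗N}`. (The factors commute;
the product is written in increasing order of the parties.) -/
noncomputable def localProduct (S : NPartiteSystem N H) {d : ℕ} (u : S.LocalFamily d) :
    Matrix (Fin N → Fin d) (Fin N → Fin d) S.joint.toStarSubalgebra :=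
  (List.ofFn fun x => atParty x ((u x).map (incl (S.party_le_joint x)))).prod

/-- The norm `‖u (ω ⊗ φ) u* - ω ⊗ ψ‖` with `u = ∏ₓ uₓ`. -/
noncomputable def embezzlingError (S : NPartiteSystem N H) (ω : NormalState S.joint) {d : ℕ}
    (φ ψ : EuclideanSpace ℂ (Fin N → Fin d)) (u : S.LocalFamily d) : ℝ≥0∞ :=
  functionalNorm
    (conjFunctional (S.localProduct u) (tensorVectorState ω φ) - tensorVectorState ω ψ)

/-- `ω` is an `N`-partite embezzling state. The pure states on the `N`-partite system on
`(ℂ^d)^{⊗N}` are given by the unit vectors. -/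
def IsEmbezzling (S : NPartiteSystem N H) (ω : NormalState S.joint) : Prop :=
  ∀ (d : ℕ) (ψ φ : EuclideanSpace ℂ (Fin N → Fin d)), ‖ψ‖ = 1 → ‖φ‖ = 1 →
    ∀ ε : ℝ, 0 < ε → ∃ u : S.LocalFamily d, (∀ x, u x ∈ unitary _) ∧
      S.embezzlingError ω φ ψ u < ENNReal.ofReal ε

end NPartiteSystem

/-- An increasing net of `N`-partite systems on `H`. -/
structure IncreasingNet (ι : Type*) [Preorder ι] (N : ℕ) (H : Type*) [NormedAddCommGroup H]
    [InnerProductSpace ℂ H] [CompleteSpace H] where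
  /-- the system at the stage `n` -/
  stage : ι → NPartiteSystem N H
  mono : ∀ x, Monotone fun n => (stage n).party x

namespace IncreasingNet

variable {ι : Type*} [Preorder ι] {N : ℕ} {H : Type*} [NormedAddCommGroup H]
  [InnerProductSpace ℂ H] [CompleteSpace H]

/-- The system `S` is generated by the increasing net `T` of subsystems. -/
def Generates (T : IncreasingNet ι N H) (S : NPartiteSystem N H) : Prop :=
  ∀ x, S.party x = join fun n => (T.stage n).party x

theorem Generates.joint_le {T : IncreasingNet ι N H} {S : NPartiteSystem N H}
    (h : T.Generates S) (n : ι) : (T.stage n).joint ≤ S.joint :=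
  NPartiteSystem.joint_mono fun x => by
    rw [h x]
    exact le_join (fun n => (T.stage n).party x) n

theorem stage_joint_mono (T : IncreasingNet ι N H) {n m : ι} (h : n ≤ m) :
    (T.stage n).joint ≤ (T.stage m).joint :=
  NPartiteSystem.joint_mono fun x => T.mono x h

/-- Local elements at the stage `n`, regarded as local elements at a later stage `m`. -/
noncomputable def transport (T : IncreasingNet ι N H) {n m : ι} (h : n ≤ m) {d : ℕ}
    (u : (T.stage n).LocalFamily d) : (T.stage m).LocalFamily d :=
  fun x => (u x).map (incl (T.mono x h))

/-- The normal states `ω n` form an `N`-partite embezzling family. -/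
def IsEmbezzlingFamily (T : IncreasingNet ι N H) (ω : ∀ n, NormalState (T.stage n).joint) :
    Prop :=
  ∀ (d : ℕ) (ε : ℝ), 0 < ε → ∃ n, ∀ m, n ≤ m →
    ∀ ψ φ : EuclideanSpace ℂ (Fin N → Fin d), ‖ψ‖ = 1 → ‖φ‖ = 1 →
      ∃ u : (T.stage m).LocalFamily d, (∀ x, u x ∈ unitary _) ∧
        (T.stage m).embezzlingError (ω m) φ ψ u < ENNReal.ofReal ε

/-- A quasi-consistent embezzling family: the unitaries are chosen at the stage `n` and serve for
all later stages `m`. -/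
def IsQuasiConsistentEmbezzlingFamily (T : IncreasingNet ι N H)
    (ω : ∀ n, NormalState (T.stage n).joint) : Prop :=
  T.IsEmbezzlingFamily ω ∧
  ∀ (d : ℕ) (ε : ℝ), 0 < ε → ∃ n,
    ∀ ψ φ : EuclideanSpace ℂ (Fin N → Fin d), ‖ψ‖ = 1 → ‖φ‖ = 1 →
      ∃ u : (T.stage n).LocalFamily d, (∀ x, u x ∈ unitary _) ∧
        ∀ (m : ι) (h : n ≤ m),
          (T.stage m).embezzlingError (ω m) φ ψ (T.transport h u) < ENNReal.ofReal ε

/-- A consistent embezzling family: it is quasi-consistent, and every state is the restriction of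
each later one. -/
def IsConsistentEmbezzlingFamily (T : IncreasingNet ι N H)
    (ω : ∀ n, NormalState (T.stage n).joint) : Prop :=
  T.IsQuasiConsistentEmbezzlingFamily ω ∧
  ∀ (n m : ι) (h : n ≤ m), ω n = (ω m).restrict (T.stage_joint_mono h)

end IncreasingNet

end Embezzlement

/-!
A consistent embezzling family is obtained from the embezzling state `ω` by restriction, so the
point is to find, for given `d` and `ε`, one stage `n` whose local unitaries already do the job for
all pairs of pure states and for the state `ω` on the whole joint algebra
(`IncreasingNet.Generates.exists_uniform_stage`). Restricting `ω` to a stage `m ≥ n` only decreases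
the norm of the functional, and this gives the embezzling property and quasi-consistency at once.

For a fixed pair of pure states, take local unitaries `u x ∈ M x ⊗ M_d(ℂ)` that work for `ω`. By a
unitary form of Kaplansky's density theorem (`unitary_mem_strongClosure`, transferred to matrices in
`exists_filter_entrywiseTendsto`), each `u x` is a strong limit of unitaries of the algebras
`M⁽ⁿ⁾ x ⊗ M_d(ℂ)`. Products of unitaries are jointly strongly continuous, so `v = ∏ v x → u = ∏ u x`
strongly. For the positive functional `f = ω ⊗ φ` the Cauchy-Schwarz inequality yields
`‖v f v* - u f u*‖ ≤ 2 f((v - u)* (v - u)) ^ (1/2)`, and the right-hand side tends to zero because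
`ω` is normal. Finally, the error depends continuously on the two vectors, uniformly in the
unitaries, and compactness of the unit spheres makes the stage uniform.

The density theorem is proved without Borel functional calculus. The Cayley transform
`h ↦ (h - i) (h + i)⁻¹` is strongly continuous on the self-adjoint operators by the resolvent
identity, with no bound on norms, so Cayley transforms of self-adjoint elements of the generated
algebra are strong limits of unitaries of the stages. If `P` is the projection onto the fixed
vectors of a unitary `u`, then `u - 2 P` is a strong limit of Cayley transforms
(`sub_add_self_mem_strongClosure_cayley`), the symmetry `s = 1 - 2 P` is `i` times its own Cayley
transform, and `u = (u - 2 P) s`.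
-/

namespace Embezzlement

/-! ### Matrices of operators as operators on a direct sum -/

section Block

variable {K : Type*} [NormedAddCommGroup K] [InnerProductSpace ℂ K] {κ : Type*}

/-- The Hilbert space direct sum of copies of `K` indexed by `κ`. -/
abbrev Amplification (K κ : Type*) : Type _ := PiLp 2 fun _ : κ => K

/-- The operator on the direct sum given by a matrix of operators. -/
noncomputable def blockCLM [Fintype κ] (a : Matrix κ κ (K →L[ℂ] K)) :
    Amplification K κ →L[ℂ] Amplification K κ :=
  ((PiLp.continuousLinearEquiv 2 ℂ fun _ : κ => K).symm : (κ → K) →L[ℂ] Amplification K κ) ∘L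
    ContinuousLinearMap.pi fun i => ∑ j, a i j ∘L PiLp.proj 2 (fun _ : κ => K) j

@[simp]
theorem blockCLM_apply [Fintype κ] (a : Matrix κ κ (K →L[ℂ] K)) (ξ : Amplification K κ) (i : κ) :
    blockCLM a ξ i = ∑ j, a i j (ξ j) := by
  simp [blockCLM]

/-- The matrix entries of an operator on the direct sum. -/
noncomputable def blockEntry [DecidableEq κ] (T : Amplification K κ →L[ℂ] Amplification K κ) :
    Matrix κ κ (K →L[ℂ] K) :=
  Matrix.of fun i j => PiLp.proj 2 (fun _ : κ => K) i ∘L T ∘L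
    ((PiLp.continuousLinearEquiv 2 ℂ fun _ : κ => K).symm : (κ → K) →L[ℂ] Amplification K κ) ∘L
      ContinuousLinearMap.single ℂ (fun _ : κ => K) j

theorem blockEntry_apply [DecidableEq κ] (T : Amplification K κ →L[ℂ] Amplification K κ)
    (i j : κ) (x : K) :
    blockEntry T i j x = T (PiLp.single 2 j x) i := by
  simp [blockEntry]

variable [CompleteSpace K] [Fintype κ] [DecidableEq κ]

variable (K κ) in
/-- Matrices of operators on `K` are the same as operators on the direct sum of copies
of `K`. -/
noncomputable def blockOp :
    Matrix κ κ (K →L[ℂ] K) ≃⋆ₐ[ℂ] (Amplification K κ →L[ℂ] Amplification K κ) where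
  toFun := blockCLM
  invFun := blockEntry
  left_inv a := by
    ext i j x
    simp only [blockEntry_apply, blockCLM_apply]
    rw [Finset.sum_eq_single j] <;> simp +contextual
  right_inv T := by
    ext ξ i
    simp only [blockCLM_apply, blockEntry_apply]
    have : ξ = ∑ j, PiLp.single 2 j (ξ j) := by
      ext i
      simp
    conv_rhs => rw [this, map_sum]
    simp
  map_mul' a b := by
    ext ξ i
    simp only [blockCLM_apply, Matrix.mul_apply, mul_apply_eq_comp, map_sum,
      sum_apply]
    exact Finset.sum_comm
  map_add' a b := by
    ext ξ i
    simp [Finset.sum_add_distrib]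
  map_smul' c a := by
    ext ξ i
    simp [Finset.smul_sum]
  map_star' a := by
    rw [ContinuousLinearMap.star_eq_adjoint, ContinuousLinearMap.eq_adjoint_iff]
    intro ξ η
    simp only [PiLp.inner_apply, blockCLM_apply, sum_inner, inner_sum, Matrix.star_apply,
      ContinuousLinearMap.star_eq_adjoint, ContinuousLinearMap.adjoint_inner_left]
    exact Finset.sum_comm

theorem blockOp_apply (a : Matrix κ κ (K →L[ℂ] K)) (ξ : Amplification K κ) (i : κ) :
    blockOp K κ a ξ i = ∑ j, a i j (ξ j) := blockCLM_apply a ξ i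

theorem blockOp_symm_apply (T : Amplification K κ →L[ℂ] Amplification K κ) (i j : κ) (x : K) :
    (blockOp K κ).symm T i j x = T (PiLp.single 2 j x) i := blockEntry_apply T i j x

variable (κ) in
/-- The diagonal operator `c ⊕ ⋯ ⊕ c`. -/
noncomputable def diagOp (c : K →L[ℂ] K) : Amplification K κ →L[ℂ] Amplification K κ :=
  blockOp K κ (Matrix.scalar κ c)

@[simp]
theorem diagOp_apply (c : K →L[ℂ] K) (ξ : Amplification K κ) (i : κ) :
    diagOp κ c ξ i = c (ξ i) := by
  rw [diagOp, blockOp_apply, Finset.sum_eq_single i] <;>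
    simp +contextual [eq_comm]

theorem diagOp_star (c : K →L[ℂ] K) : diagOp κ (star c) = star (diagOp κ c) := by
  rw [diagOp, diagOp, ← map_star]
  congr 1
  simp [Matrix.star_eq_conjTranspose]

theorem commute_diagOp_iff (c : K →L[ℂ] K) (T : Amplification K κ →L[ℂ] Amplification K κ) :
    Commute (diagOp κ c) T ↔ ∀ i j, Commute c ((blockOp K κ).symm T i j) := by
  obtain ⟨a, rfl⟩ : ∃ a, T = blockOp K κ a := ⟨(blockOp K κ).symm T, by simp⟩
  have h : Commute (diagOp κ c) (blockOp K κ a) ↔ Commute (Matrix.scalar κ c) a := by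
    simp only [diagOp, Commute, SemiconjBy, ← map_mul, EmbeddingLike.apply_eq_iff_eq]
  rw [h, Matrix.scalar_commute_iff, ← Matrix.ext_iff]
  simp [Commute, SemiconjBy]

end Block

/-! ### Strong operator closure -/

section Strong

variable {K : Type*} [NormedAddCommGroup K] [InnerProductSpace ℂ K]

/-- The closure of a set of operators in the strong operator topology. -/
def strongClosure (G : Set (K →L[ℂ] K)) : Set (K →L[ℂ] K) :=
  {u | ∀ (s : Finset K) (ε : ℝ), 0 < ε → ∃ a ∈ G, ∀ ξ ∈ s, ‖a ξ - u ξ‖ < ε}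

theorem subset_strongClosure (G : Set (K →L[ℂ] K)) : G ⊆ strongClosure G :=
  fun a ha _ ε hε => ⟨a, ha, fun ξ _ => by simpa using hε⟩

theorem strongClosure_mono {G G' : Set (K →L[ℂ] K)} (h : G ⊆ G') :
    strongClosure G ⊆ strongClosure G' := fun _ hu s ε hε =>
  let ⟨a, ha, h'⟩ := hu s ε hε
  ⟨a, h ha, h'⟩

theorem strongClosure_idem (G : Set (K →L[ℂ] K)) :
    strongClosure (strongClosure G) ⊆ strongClosure G := by
  intro u hu s ε hε
  obtain ⟨a, ha, h⟩ := hu s (ε / 2) (by positivity)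
  obtain ⟨b, hb, h'⟩ := ha s (ε / 2) (by positivity)
  refine ⟨b, hb, fun ξ hξ => ?_⟩
  have := norm_sub_le_norm_sub_add_norm_sub (b ξ) (a ξ) (u ξ)
  linarith [h ξ hξ, h' ξ hξ]

/-- Points of the strong closure are limits of nets, which are encoded as filters. -/
theorem exists_filter_of_mem_strongClosure {G : Set (K →L[ℂ] K)} {u : K →L[ℂ] K}
    (hu : u ∈ strongClosure G) :
    ∃ l : Filter (K →L[ℂ] K), l.NeBot ∧ G ∈ l ∧
      ∀ ξ, Filter.Tendsto (fun a : K →L[ℂ] K => a ξ) l (nhds (u ξ)) := by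
  classical
  choose a ha h using fun p : Finset K × ℕ => hu p.1 (1 / ((p.2 : ℝ) + 1)) (by positivity)
  refine ⟨Filter.map a Filter.atTop, inferInstance, Filter.mem_map.2
    (Filter.Eventually.of_forall ha), fun ξ => ?_⟩
  rw [Filter.tendsto_map'_iff, Metric.tendsto_atTop]
  intro ε hε
  obtain ⟨n, hn⟩ := exists_nat_one_div_lt hε
  refine ⟨({ξ}, n), fun p hp => ?_⟩
  have h1 : ξ ∈ p.1 := hp.1 (by simp)
  have h2 : (n : ℝ) ≤ p.2 := by exact_mod_cast hp.2
  rw [dist_eq_norm]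
  refine (h p ξ h1).trans_le (le_trans ?_ hn.le)
  gcongr

theorem mem_strongClosure_of_filter {G : Set (K →L[ℂ] K)} {u : K →L[ℂ] K}
    {α : Type*} (l : Filter α) [l.NeBot] (a : α → K →L[ℂ] K) (ha : ∀ᶠ t in l, a t ∈ G)
    (h : ∀ ξ, Filter.Tendsto (fun t => a t ξ) l (nhds (u ξ))) : u ∈ strongClosure G := by
  intro s ε hε
  have h1 : ∀ᶠ t in l, ∀ ξ ∈ s, ‖a t ξ - u ξ‖ < ε := by
    rw [Filter.eventually_all_finset]
    intro ξ _
    simpa [dist_eq_norm] using (Metric.tendsto_nhds.1 (h ξ)) ε hε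
  obtain ⟨t, ht, ht'⟩ := (ha.and h1).exists
  exact ⟨a t, ht, ht'⟩

/-- Multiplication is jointly strongly continuous on contractions. -/
theorem mul_mem_strongClosure {G : Set (K →L[ℂ] K)} (hG : ∀ a ∈ G, ∀ b ∈ G, a * b ∈ G)
    (hc : ∀ a ∈ G, ∀ ξ, ‖a ξ‖ ≤ ‖ξ‖) {u v : K →L[ℂ] K} (hu : u ∈ strongClosure G)
    (hv : v ∈ strongClosure G) : u * v ∈ strongClosure G := by
  classical
  intro s ε hε
  obtain ⟨a, ha, h⟩ := hu (s.image v) (ε / 2) (by positivity)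
  obtain ⟨b, hb, h'⟩ := hv s (ε / 2) (by positivity)
  refine ⟨a * b, hG a ha b hb, fun ξ hξ => ?_⟩
  have h1 := h (v ξ) (Finset.mem_image_of_mem _ hξ)
  have h2 := hc a ha (b ξ - v ξ)
  rw [map_sub] at h2
  have h3 := norm_sub_le_norm_sub_add_norm_sub (a (b ξ)) (a (v ξ)) (u (v ξ))
  have h4 := h' ξ hξ
  simp only [mul_apply_eq_comp]
  linarith

end Strong

/-! ### The double commutant theorem and its self-adjoint version -/

section Density

variable {K : Type*} [NormedAddCommGroup K] [InnerProductSpace ℂ K] [CompleteSpace K]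

theorem commute_starProjection (V : Submodule ℂ K) [V.HasOrthogonalProjection] (T : K →L[ℂ] K)
    (h : ∀ x ∈ V, T x ∈ V) (h' : ∀ x ∈ V, star T x ∈ V) : Commute T V.starProjection := by
  have key : ∀ S : K →L[ℂ] K, (∀ x ∈ V, S x ∈ V) →
      V.starProjection * (S * V.starProjection) = S * V.starProjection := by
    intro S hS
    ext x
    simp only [mul_apply_eq_comp]
    exact V.starProjection_eq_self_iff.2 (hS _ (V.starProjection_apply_mem x))
  have hp : star V.starProjection = V.starProjection :=
    (isStarProjection_starProjection (U := V)).isSelfAdjoint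
  have h1 := key T h
  have h2 := congrArg star (key (star T) h')
  simp only [star_mul, star_star, hp] at h2
  rw [Commute, SemiconjBy, ← h1, ← h2, mul_assoc]

/-- The non-trivial inclusion of von Neumann's double commutant theorem. For finitely many vectors,
the orthogonal projection onto the closure of the orbit of their direct sum `ζ` under the diagonal
action of `A` has matrix entries in the commutant of `A`. -/
theorem centralizer_centralizer_subset_strongClosure (A : StarSubalgebra ℂ (K →L[ℂ] K)) :
    Set.centralizer (Set.centralizer (A : Set (K →L[ℂ] K))) ⊆
      strongClosure (A : Set (K →L[ℂ] K)) := by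
  classical
  intro h hh s ε hε
  let ζ : Amplification K s := WithLp.toLp 2 fun ξ => (ξ : K)
  let f : A →ₗ[ℂ] Amplification K s :=
    { toFun := fun a => diagOp s (a : K →L[ℂ] K) ζ
      map_add' := fun a b => by ext i; simp
      map_smul' := fun c a => by ext i; simp }
  let V : Submodule ℂ (Amplification K s) := (LinearMap.range f).topologicalClosure
  have hVinv : ∀ a ∈ A, ∀ x ∈ V, diagOp s a x ∈ V := by
    intro a ha x hx
    refine map_mem_closure (diagOp s a).continuous hx ?_
    rintro _ ⟨b, rfl⟩
    refine ⟨⟨a, ha⟩ * b, ?_⟩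
    ext i
    simp [f]
  have hζ : ζ ∈ V := by
    refine Submodule.le_topologicalClosure _ ⟨1, ?_⟩
    ext i
    simp [f]
  have hcomm : Commute (diagOp s h) V.starProjection := by
    rw [commute_diagOp_iff]
    intro i j
    refine (Set.mem_centralizer_iff.1 hh _ ?_).symm
    rw [Set.mem_centralizer_iff]
    intro a ha
    exact (commute_diagOp_iff a _).1 (commute_starProjection V _ (hVinv a ha) fun x hx => by
      rw [← diagOp_star]
      exact hVinv _ (star_mem ha) x hx) i j
  have hmem : diagOp s h ζ ∈ V := by
    have h1 := congrArg (fun T : Amplification K s →L[ℂ] Amplification K s => T ζ) hcomm.eq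
    simp only [mul_apply_eq_comp, V.starProjection_eq_self_iff.2 hζ] at h1
    rw [h1]
    exact V.starProjection_apply_mem _
  obtain ⟨_, ⟨a, rfl⟩, ha⟩ := Metric.mem_closure_iff.1 hmem ε hε
  refine ⟨a, a.2, fun ξ hξ => ?_⟩
  rw [dist_comm, dist_eq_norm] at ha
  refine lt_of_le_of_lt ?_ ha
  simpa [f, ζ] using PiLp.norm_apply_le (f a - diagOp s h ζ) ⟨ξ, hξ⟩

/-- A self-adjoint operator in the strong closure of a `*`-subalgebra is in the strong closure of
its self-adjoint part. The real parts of an approximating net converge only weakly, so the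
approximating vectors are found by a projection in a real Hilbert space. -/
theorem mem_strongClosure_selfAdjoint (A : StarSubalgebra ℂ (K →L[ℂ] K)) {h : K →L[ℂ] K}
    (hA : h ∈ strongClosure (A : Set (K →L[ℂ] K))) (hh : star h = h) :
    h ∈ strongClosure {a : K →L[ℂ] K | a ∈ A ∧ star a = a} := by
  classical
  obtain ⟨l, hl, hAl, hlim⟩ := exists_filter_of_mem_strongClosure hA
  intro s ε hε
  let E := Amplification K s
  let : InnerProductSpace ℝ E := InnerProductSpace.rclikeToReal ℂ E
  have hin : ∀ x y : E, inner ℝ x y = (∑ i, inner ℂ (x i) (y i)).re := by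
    intro x y
    rw [← PiLp.inner_apply]
    rfl
  let ζ : E := WithLp.toLp 2 fun ξ => (ξ : K)
  let W : Submodule ℝ E :=
    { carrier := {x | ∃ a ∈ A, star a = a ∧ diagOp s a ζ = x}
      add_mem' := by
        rintro _ _ ⟨a, ha, ha', rfl⟩ ⟨b, hb, hb', rfl⟩
        refine ⟨a + b, add_mem ha hb, by rw [star_add, ha', hb'], ?_⟩
        ext i
        simp [PiLp.add_apply _ (diagOp s a ζ) (diagOp s b ζ)]
      zero_mem' := ⟨0, zero_mem _, star_zero _, by ext i; simp⟩
      smul_mem' := by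
        rintro c _ ⟨a, ha, ha', rfl⟩
        refine ⟨(c : ℂ) • a, A.smul_mem ha _, by simp [ha'], ?_⟩
        ext i
        simp [PiLp.smul_apply _ c (diagOp s a ζ)] }
  let V := W.topologicalClosure
  have : CompleteSpace V := W.isClosed_topologicalClosure.completeSpace_coe
  have horth : ∀ η ∈ Vᗮ, inner ℝ η (diagOp s h ζ) = 0 := by
    intro η hη
    have h1 : ∀ a ∈ A, (∑ i, inner ℂ (η i) (a (ζ i))).re +
        (∑ i, inner ℂ (a (η i)) (ζ i)).re = 0 := by
      intro a ha
      have hmem : diagOp s (a + star a) ζ ∈ V := W.le_topologicalClosure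
        ⟨a + star a, add_mem ha (star_mem ha), by rw [star_add, star_star, add_comm], rfl⟩
      have h2 := (Submodule.mem_orthogonal' _ _).1 hη _ hmem
      rw [hin] at h2
      simpa [inner_add_right, Finset.sum_add_distrib, ContinuousLinearMap.star_eq_adjoint,
        ContinuousLinearMap.adjoint_inner_right] using h2
    have h3 : Filter.Tendsto (fun a : K →L[ℂ] K => (∑ i, inner ℂ (η i) (a (ζ i))).re +
        (∑ i, inner ℂ (a (η i)) (ζ i)).re) l
        (nhds ((∑ i, inner ℂ (η i) (h (ζ i))).re + (∑ i, inner ℂ (h (η i)) (ζ i)).re)) := by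
      refine Filter.Tendsto.add ?_ ?_
      · exact (Complex.continuous_re.tendsto _).comp (tendsto_finsetSum _ fun i _ =>
          Filter.Tendsto.inner tendsto_const_nhds (hlim _))
      · exact (Complex.continuous_re.tendsto _).comp (tendsto_finsetSum _ fun i _ =>
          Filter.Tendsto.inner (hlim _) tendsto_const_nhds)
    have h4 := tendsto_nhds_unique h3 (tendsto_const_nhds.congr' (by
      filter_upwards [hAl] with a ha using (h1 a ha).symm))
    have h5 : ∀ x y : K, inner ℂ (h x) y = inner ℂ x (h y) := by
      intro x y
      conv_lhs => rw [← hh]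
      rw [ContinuousLinearMap.star_eq_adjoint, ContinuousLinearMap.adjoint_inner_left]
    simp only [h5] at h4
    rw [hin]
    simp only [diagOp_apply]
    linarith
  have hmem : diagOp s h ζ ∈ V := by
    rw [← V.orthogonal_orthogonal, Submodule.mem_orthogonal]
    exact horth
  obtain ⟨_, ⟨a, haA, ha', rfl⟩, ha⟩ := Metric.mem_closure_iff.1 hmem ε hε
  refine ⟨a, ⟨haA, ha'⟩, fun ξ hξ => ?_⟩
  rw [dist_comm, dist_eq_norm] at ha
  refine lt_of_le_of_lt ?_ ha
  simpa [ζ] using PiLp.norm_apply_le (diagOp s a ζ - diagOp s h ζ) ⟨ξ, hξ⟩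

end Density

/-! ### The Cayley transform of self-adjoint elements -/

section Cayley

open Complex

variable {B : Type*} [CStarAlgebra B]

theorem isUnit_add_I_smul_one {h : B} (hh : star h = h) : IsUnit (h + I • (1 : B)) := by
  have h1 : -I ∉ spectrum ℂ h := by
    intro hI
    have := IsSelfAdjoint.mem_spectrum_eq_re (show IsSelfAdjoint h from hh) hI
    simpa using congrArg Complex.im this
  rw [spectrum.notMem_iff, Algebra.algebraMap_eq_smul_one, neg_smul, ← neg_add', IsUnit.neg_iff,
    add_comm] at h1
  exact h1

/-- The Cayley transform `(h - i) (h + i)⁻¹ = 1 - 2i (h + i)⁻¹`. It is meant for self-adjoint `h`,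
where `h + i` is invertible and `Ring.inverse` is the genuine inverse. -/
noncomputable def cayley (h : B) : B := 1 - (2 * I) • Ring.inverse (h + I • (1 : B))

theorem cayley_eq_of_mul_eq_one {h S : B} (hh : star h = h) (hS : S * (h + I • (1 : B)) = 1) :
    cayley h = 1 - (2 * I) • S := by
  have hu := isUnit_add_I_smul_one hh
  rw [cayley, hu.mul_left_injective ((Ring.inverse_mul_cancel _ hu).trans hS.symm)]

theorem star_inverse_mul_sub {h : B} (hh : star h = h) :
    star (Ring.inverse (h + I • (1 : B))) * (h - I • (1 : B)) = 1 := by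
  have := congrArg star (Ring.mul_inverse_cancel _ (isUnit_add_I_smul_one hh))
  simpa [hh, ← sub_eq_add_neg] using this

theorem sub_mul_star_inverse {h : B} (hh : star h = h) :
    (h - I • (1 : B)) * star (Ring.inverse (h + I • (1 : B))) = 1 := by
  have := congrArg star (Ring.inverse_mul_cancel _ (isUnit_add_I_smul_one hh))
  simpa [hh, ← sub_eq_add_neg] using this

theorem cayley_mem_unitary {h : B} (hh : star h = h) : cayley h ∈ unitary B := by
  have hu := isUnit_add_I_smul_one hh
  have h1 := Ring.inverse_mul_cancel _ hu
  have h2 := Ring.mul_inverse_cancel _ hu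
  have h3 := star_inverse_mul_sub hh
  have h4 := sub_mul_star_inverse hh
  rw [cayley]
  set R := Ring.inverse (h + I • (1 : B))
  -- the resolvent identity for the points `i` and `-i`, with both orders of the factors
  have e1 : star R - R = (2 * I) • (star R * R) := by
    calc star R - R = star R * ((h + I • (1 : B)) * R) - star R * (h - I • (1 : B)) * R := by
          rw [h2, h3, mul_one, one_mul]
      _ = (2 * I) • (star R * R) := by
          rw [two_mul, add_smul]
          simp only [mul_add, add_mul, mul_sub, sub_mul, mul_assoc, smul_mul_assoc,
            mul_smul_comm, one_mul]
          abel
  have e2 : star R - R = (2 * I) • (R * star R) := by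
    calc star R - R = R * (h + I • (1 : B)) * star R - R * ((h - I • (1 : B)) * star R) := by
          rw [h1, h4, mul_one, one_mul]
      _ = (2 * I) • (R * star R) := by
          rw [two_mul, add_smul]
          simp only [mul_add, add_mul, mul_sub, sub_mul, mul_assoc, smul_mul_assoc,
            mul_smul_comm, one_mul]
          abel
  have hs : star (1 - (2 * I) • R) = 1 + (2 * I) • star R := by
    simp
  rw [Unitary.mem_iff, hs]
  constructor
  · have : (1 + (2 * I) • star R) * (1 - (2 * I) • R) =
        1 + (2 * I) • ((star R - R) - (2 * I) • (star R * R)) := by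
      simp only [add_mul, mul_sub, smul_sub, smul_add, smul_mul_assoc, mul_smul_comm, one_mul,
        mul_one]
      abel
    rw [this, e1, sub_self, smul_zero, add_zero]
  · have : (1 - (2 * I) • R) * (1 + (2 * I) • star R) =
        1 + (2 * I) • ((star R - R) - (2 * I) • (R * star R)) := by
      simp only [sub_mul, mul_add, smul_sub, smul_mul_assoc, mul_smul_comm, one_mul, mul_one]
      abel
    rw [this, e2, sub_self, smul_zero, add_zero]

theorem norm_le_one_of_mem_unitary {u : B} (hu : u ∈ unitary B) : ‖u‖ ≤ 1 := by
  rcases subsingleton_or_nontrivial B with _ | _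
  · simp [Subsingleton.elim u 0]
  · exact (CStarRing.norm_of_mem_unitary hu).le

theorem norm_inverse_add_I_le_one {h : B} (hh : star h = h) :
    ‖Ring.inverse (h + I • (1 : B))‖ ≤ 1 := by
  have h1 : (2 * I) • Ring.inverse (h + I • (1 : B)) = 1 - cayley h := by simp [cayley]
  have h2 := congrArg norm h1
  rw [norm_smul] at h2
  have h3 := norm_sub_le (1 : B) (cayley h)
  have h4 := norm_le_one_of_mem_unitary (cayley_mem_unitary hh)
  have h5 := norm_le_one_of_mem_unitary (one_mem (unitary B))
  simp only [norm_mul, Complex.norm_ofNat, Complex.norm_I, mul_one] at h2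
  linarith

/-- A bounded self-adjoint function of `u` whose Cayley transform is close to `u` away from the
eigenvalue `1`. With `D = 2 - u - u*` and `R = (t D + i)⁻¹` it is `i t² (u - u*) D R R*`; as
`t → ∞` it approaches the unbounded `i (u - u*) / D = i (1 + u) / (1 - u)`. -/
theorem exists_selfAdjoint_cayley_near {C : Type*} [CommCStarAlgebra C] {u : C}
    (hu : u ∈ unitary C) {t : ℝ} (ht : 0 < t) :
    ∃ h q : C, star h = h ∧ h = q * (u - star u) ∧
      ‖(cayley h - u) * (2 - u - star u)‖ ≤ 4 / t := by
  have huu : u * star u = 1 := (Unitary.mem_iff.1 hu).2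
  set i : C := I • (1 : C) with hi
  have hii : i * i = -1 := by simp [hi, smul_smul]
  have hsi : star i = -i := by simp [hi]
  set τ : C := (t : ℂ) • (1 : C) with hτ
  have hsτ : star τ = τ := by simp [hτ]
  set D : C := 2 - u - star u with hD
  have hsD : star D = D := by
    rw [hD]
    simp only [star_sub, star_star, star_ofNat]
    ring
  have hk : star (τ * D) = τ * D := by rw [star_mul, hsD, hsτ, mul_comm]
  have hR := Ring.inverse_mul_cancel _ (isUnit_add_I_smul_one hk)
  have hRs := star_inverse_mul_sub hk
  have hRn := norm_inverse_add_I_le_one hk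
  rw [← hi] at hR hRs hRn
  set R := Ring.inverse (τ * D + i)
  set q : C := i * τ ^ 2 * D * R * star R with hq
  set h : C := q * (u - star u) with hh
  have hsh : star h = h := by
    rw [hh, hq]
    simp only [star_mul, star_sub, star_star, star_pow, hsi, hsD, hsτ]
    ring
  have hS := Ring.inverse_mul_cancel _ (isUnit_add_I_smul_one hsh)
  have hSn := norm_inverse_add_I_le_one hsh
  rw [← hi] at hS hSn
  have hc : cayley h = 1 - 2 * i * Ring.inverse (h + i) := by
    rw [cayley, ← hi, hi]
    simp [two_mul, add_smul]
  set S := Ring.inverse (h + i)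
  have e1 : τ ^ 2 * D ^ 2 * R * star R = 1 - R * star R := by
    linear_combination (star R * (τ * D - i)) * hR + hRs + (R * star R) * hii
  have e2 : (u - star u) * (1 - u) = (1 + u) * D := by
    rw [hD]
    linear_combination 2 * huu
  have e3 : h * (1 - u) = i * (1 + u) * (1 - R * star R) := by
    rw [hh, hq]
    linear_combination (i * τ ^ 2 * D * R * star R) * e2 + i * (1 + u) * e1
  have e4 : cayley h - u = -(S * (i * (1 + u) * (R * star R))) := by
    rw [hc]
    linear_combination (-1 + u) * hS + S * e3
  have e5 : τ * ((cayley h - u) * D) = -(S * (i * ((1 + u) * (R * (1 + i * star R))))) := by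
    rw [e4]
    linear_combination (-S * i * (1 + u) * R) * hRs
  have hn1 : ‖(1 : C)‖ ≤ 1 := norm_le_one_of_mem_unitary (one_mem _)
  have hin : ‖i‖ ≤ 1 := by
    rw [hi, norm_smul]
    simpa using hn1
  have hun : ‖1 + u‖ ≤ 2 :=
    (norm_add_le _ _).trans (by linarith [norm_le_one_of_mem_unitary hu])
  have hRsn : ‖1 + i * star R‖ ≤ 2 := by
    refine (norm_add_le _ _).trans ?_
    have : ‖i * star R‖ ≤ 1 * 1 := norm_mul_le_of_le hin (by rwa [norm_star])
    linarith
  have hfin : ‖τ * ((cayley h - u) * D)‖ ≤ 1 * (1 * (2 * (1 * 2))) := by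
    rw [e5, norm_neg]
    exact norm_mul_le_of_le hSn (norm_mul_le_of_le hin (norm_mul_le_of_le hun
      (norm_mul_le_of_le hRn hRsn)))
  refine ⟨h, q, hsh, hh, ?_⟩
  rw [hτ, smul_mul_assoc, one_mul, norm_smul, Complex.norm_real, Real.norm_of_nonneg ht.le] at hfin
  rw [le_div_iff₀ ht]
  linarith

end Cayley

/-! ### Density of unitaries -/

section Unitary

open Complex

variable {K : Type*} [NormedAddCommGroup K] [InnerProductSpace ℂ K]

theorem tendsto_zero_of_mem_closure_range {X : ℕ → K →L[ℂ] K} {D : K →L[ℂ] K} {c : ℝ}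
    (hX : ∀ n η, ‖X n η‖ ≤ c * ‖η‖) (hXD : Filter.Tendsto (fun n => X n * D) Filter.atTop (nhds 0))
    {η : K} (hη : η ∈ closure (Set.range D)) :
    Filter.Tendsto (fun n => X n η) Filter.atTop (nhds 0) := by
  rw [Metric.tendsto_nhds]
  intro ε hε
  obtain ⟨_, ⟨ζ, rfl⟩, hζ⟩ := Metric.mem_closure_iff.1 hη (ε / (2 * (|c| + 1))) (by positivity)
  have h0 : Filter.Tendsto (fun n => (X n * D) ζ) Filter.atTop (nhds 0) := by
    exact ((ContinuousLinearMap.apply ℂ K ζ).continuous.tendsto 0).comp hXD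
  filter_upwards [(Metric.tendsto_nhds.1 h0) (ε / 2) (by positivity)] with n hn
  have h1 : X n η = X n (η - D ζ) + (X n * D) ζ := by
    rw [map_sub, mul_apply_eq_comp]
    abel
  rw [dist_eq_norm, lt_div_iff₀ (by positivity)] at hζ
  rw [dist_zero_right] at hn ⊢
  have h2 := hX n (η - D ζ)
  have h3 : c * ‖η - D ζ‖ ≤ |c| * ‖η - D ζ‖ := by
    gcongr
    exact le_abs_self c
  rw [h1]
  refine (norm_add_le _ _).trans_lt ?_
  nlinarith [norm_nonneg (η - D ζ)]

variable [CompleteSpace K]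

theorem isClosed_vonNeumannAlgebra (M : VonNeumannAlgebra K) :
    IsClosed (M.toStarSubalgebra : Set (K →L[ℂ] K)) := by
  rw [VonNeumannAlgebra.coe_toStarSubalgebra, ← M.centralizer_centralizer]
  exact Set.isClosed_centralizer _

theorem smul_mem_vonNeumannAlgebra (M : VonNeumannAlgebra K) (c : ℂ) {a : K →L[ℂ] K}
    (ha : a ∈ M) : c • a ∈ M :=
  M.toStarSubalgebra.smul_mem ha c

theorem mem_vonNeumannAlgebra_iff (M : VonNeumannAlgebra K) (a : K →L[ℂ] K) :
    a ∈ M ↔ ∀ y ∈ M.commutant, Commute y a := by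
  rw [← M.commutant_commutant, VonNeumannAlgebra.mem_commutant_iff, M.commutant_commutant]
  rfl

theorem commute_inverse {R : Type*} [MonoidWithZero R] {a b : R} (h : Commute a b) :
    Commute a (Ring.inverse b) := by
  by_cases hb : IsUnit b
  · obtain ⟨b, rfl⟩ := hb
    rw [Ring.inverse_unit]
    exact h.units_inv_right
  · rw [Ring.inverse_non_unit b hb]
    exact Commute.zero_right a

theorem cayley_mem_vonNeumannAlgebra (M : VonNeumannAlgebra K) {h : K →L[ℂ] K} (hM : h ∈ M) :
    cayley h ∈ M := by
  refine sub_mem (one_mem M) (smul_mem_vonNeumannAlgebra M _ ?_)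
  rw [mem_vonNeumannAlgebra_iff] at hM ⊢
  intro y hy
  exact commute_inverse ((hM y hy).add_right ((Commute.one_right y).smul_right I))

theorem norm_apply_of_mem_unitary {u : K →L[ℂ] K} (hu : u ∈ unitary (K →L[ℂ] K)) (ξ : K) :
    ‖u ξ‖ = ‖ξ‖ := ContinuousLinearMap.norm_map_of_mem_unitary hu ξ

/-- The Cayley transform is strongly continuous on self-adjoint operators, even without a bound
on their norms, by the resolvent identity. -/
theorem cayley_mem_strongClosure {G : Set (K →L[ℂ] K)} {h : K →L[ℂ] K} (hh : star h = h)
    (hG : ∀ a ∈ G, star a = a) (hmem : h ∈ strongClosure G) :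
    cayley h ∈ strongClosure (cayley '' G) := by
  classical
  intro s ε hε
  have h2 := Ring.mul_inverse_cancel _ (isUnit_add_I_smul_one hh)
  set R := Ring.inverse (h + I • (1 : K →L[ℂ] K)) with hR
  obtain ⟨a, ha, hlt⟩ := hmem (s.image R) (ε / 2) (by positivity)
  refine ⟨cayley a, ⟨a, ha, rfl⟩, fun ξ hξ => ?_⟩
  have h1 := Ring.inverse_mul_cancel _ (isUnit_add_I_smul_one (hG a ha))
  have h3 := norm_inverse_add_I_le_one (hG a ha)
  have key : cayley a - cayley h =
      (2 * I) • (Ring.inverse (a + I • (1 : K →L[ℂ] K)) * ((a - h) * R)) := by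
    rw [cayley, cayley, ← hR]
    set S := Ring.inverse (a + I • (1 : K →L[ℂ] K))
    have : S * ((a - h) * R) = S * (a + I • (1 : K →L[ℂ] K)) * R -
        S * ((h + I • (1 : K →L[ℂ] K)) * R) := by
      simp only [mul_add, add_mul, mul_sub, sub_mul, mul_assoc]
      abel
    rw [this, h1, h2, one_mul, mul_one, smul_sub]
    abel
  have e := congrArg (fun T : K →L[ℂ] K => T ξ) key
  simp only [sub_apply, smul_apply, mul_apply_eq_comp] at e
  rw [e, norm_smul]
  have h4 := hlt (R ξ) (Finset.mem_image_of_mem _ hξ)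
  have h5 := ContinuousLinearMap.le_of_opNorm_le _ h3 (a (R ξ) - h (R ξ))
  simp only [norm_mul, Complex.norm_ofNat, Complex.norm_I, mul_one, one_mul] at h5 ⊢
  linarith

/-- A symmetry is the multiple `i` of its own Cayley transform. -/
theorem I_smul_cayley_of_sq_eq_one {B : Type*} [CStarAlgebra B] {s : B} (hs : star s = s)
    (hs2 : s * s = 1) : I • cayley s = s := by
  have h : ((1 / 2 : ℂ) • (s - I • (1 : B))) * (s + I • (1 : B)) = 1 := by
    have h1 : (s - I • (1 : B)) * (s + I • (1 : B)) = (2 : ℂ) • (1 : B) := by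
      simp only [sub_mul, mul_add, hs2, one_mul, mul_one, mul_smul_comm, smul_mul_assoc, smul_sub,
        smul_smul, I_mul_I, neg_one_smul, two_smul]
      abel
    rw [smul_mul_assoc, h1, smul_smul]
    norm_num
  rw [cayley_eq_of_mul_eq_one hs h, smul_sub, smul_smul, smul_smul, smul_sub, smul_smul]
  have e1 : I * (2 * I * (1 / 2)) = -1 := by linear_combination I_mul_I
  have e2 : I * (2 * I) * (1 / 2) = -1 := by linear_combination I_mul_I
  rw [e2, neg_one_mul, neg_one_smul, neg_smul]
  abel

/-- Let `P` be the projection onto the eigenspace of the unitary `u` for the eigenvalue `1`. Then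
`u - 2 P` is a strong limit of Cayley transforms of self-adjoint elements of the von Neumann
algebra. -/
theorem sub_add_self_mem_strongClosure_cayley (M : VonNeumannAlgebra K) {u : K →L[ℂ] K}
    (hu : u ∈ unitary (K →L[ℂ] K)) (huM : u ∈ M) :
    ∃ P : K →L[ℂ] K, P ∈ M ∧ star P = P ∧ P * P = P ∧ u * P = P ∧
      u - (P + P) ∈ strongClosure (cayley '' {h : K →L[ℂ] K | h ∈ M ∧ star h = h}) := by
  have hu1 := (Unitary.mem_iff.1 hu).1
  have hu2 := (Unitary.mem_iff.1 hu).2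
  set D : K →L[ℂ] K := 2 - u - star u with hD
  have hsD : star D = D := by
    rw [hD]
    simp only [star_sub, star_star, star_ofNat]
    abel
  have hDf : D = star (1 - u) * (1 - u) := by
    rw [hD, star_sub, star_one, sub_mul, mul_sub, mul_sub, hu1, ← one_add_one_eq_two]
    simp only [one_mul, mul_one]
    abel
  let V : Submodule ℂ K := LinearMap.ker (D : K →ₗ[ℂ] K)
  have hVc : IsClosed (V : Set K) := D.isClosed_ker
  have : CompleteSpace V := hVc.completeSpace_coe
  set P := V.starProjection with hP
  have hPp : IsStarProjection P := isStarProjection_starProjection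
  have hDP : D * P = 0 := by
    ext ξ
    exact V.starProjection_apply_mem ξ
  have hPD : P * D = 0 := by
    have := congrArg star hDP
    rwa [star_mul, hsD, hPp.isSelfAdjoint.star_eq, star_zero] at this
  have huP : u * P = P := by
    have h0 : (1 - u) * P = 0 := by
      rw [← CStarRing.star_mul_self_eq_zero_iff, star_mul, mul_assoc, ← mul_assoc (star (1 - u)),
        ← hDf, hDP, mul_zero]
    rw [sub_mul, one_mul, sub_eq_zero] at h0
    exact h0.symm
  have husP : star u * P = P := by
    conv_lhs => rw [← huP, ← mul_assoc, hu1, one_mul]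
  have hDM : D ∈ M := by
    have h2 : (2 : K →L[ℂ] K) ∈ M := by
      rw [← one_add_one_eq_two]
      exact add_mem (one_mem M) (one_mem M)
    exact sub_mem (sub_mem h2 huM) (star_mem huM)
  have hPM : P ∈ M := by
    rw [VonNeumannAlgebra.IsStarProjection.mem_iff hPp]
    intro y hy
    rw [Module.End.mem_invtSubmodule, hP, Submodule.range_starProjection]
    intro ξ hξ
    have hc := (mem_vonNeumannAlgebra_iff M D).1 hDM y hy
    have := congrArg (fun T : K →L[ℂ] K => T ξ) hc.eq
    simp only [mul_apply_eq_comp] at this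
    have h0 : D ξ = 0 := hξ
    rw [h0, map_zero] at this
    exact this.symm
  refine ⟨P, hPM, hPp.isSelfAdjoint.star_eq, hPp.isIdempotentElem.eq, huP, ?_⟩
  have hN : IsStarNormal u := ⟨by rw [Commute, SemiconjBy, hu1, hu2]⟩
  -- the approximants, obtained in the commutative algebra generated by `u`
  have happrox : ∀ n : ℕ, ∃ h : K →L[ℂ] K, (h ∈ M ∧ star h = h) ∧ h * P = 0 ∧
      ‖(cayley h - u) * D‖ ≤ 4 / ((n : ℝ) + 1) := by
    intro n
    let C := StarAlgebra.elemental ℂ u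
    have hCM : ∀ x : C, (x : K →L[ℂ] K) ∈ M := by
      intro x
      have := StarAlgebra.elemental.le_of_mem (isClosed_vonNeumannAlgebra M) huM
      exact this x.2
    let u' : C := ⟨u, StarAlgebra.elemental.self_mem ℂ u⟩
    have hu' : u' ∈ unitary C := Unitary.mem_iff.2 ⟨Subtype.ext hu1, Subtype.ext hu2⟩
    obtain ⟨h, q, hsh, hq, hn⟩ := exists_selfAdjoint_cayley_near hu'
      (t := (n : ℝ) + 1) (by positivity)
    have hsh' : star (h : K →L[ℂ] K) = h := congrArg Subtype.val hsh
    refine ⟨h, ⟨hCM h, hsh'⟩, ?_, ?_⟩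
    · have : (h : K →L[ℂ] K) = q * (u - star u) := congrArg Subtype.val hq
      rw [this, mul_assoc, sub_mul, huP, husP, sub_self, mul_zero]
    · have hS := Ring.inverse_mul_cancel _ (isUnit_add_I_smul_one hsh)
      have hS' := congrArg (Subtype.val : C → K →L[ℂ] K) hS
      have : cayley (h : K →L[ℂ] K) = (cayley h : C) :=
        cayley_eq_of_mul_eq_one hsh' hS'
      rw [this]
      exact hn
  choose h hh hhP hn using happrox
  refine mem_strongClosure_of_filter Filter.atTop (fun n => cayley (h n))
    (Filter.Eventually.of_forall fun n => ⟨h n, hh n, rfl⟩) fun ξ => ?_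
  -- `X n = cayley (h n) - (u - 2 P)` kills the range of `P` and is small on the range of `D`
  let X : ℕ → K →L[ℂ] K := fun n => cayley (h n) - u + (P + P)
  have hXP : ∀ n, X n * P = 0 := by
    intro n
    have h1 := Ring.inverse_mul_cancel _ (isUnit_add_I_smul_one (hh n).2)
    have h2 : cayley (h n) * P = -P := by
      have h3 : I • (Ring.inverse (h n + I • (1 : K →L[ℂ] K)) * P) = P := by
        have h4 := congrArg (· * P) h1
        simp only [mul_assoc, add_mul, hhP, smul_mul_assoc, one_mul, zero_add,
          mul_smul_comm] at h4
        exact h4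
      rw [cayley, sub_mul, one_mul, smul_mul_assoc, mul_smul, h3, two_smul]
      abel
    simp only [X, add_mul, sub_mul, h2, huP, hPp.isIdempotentElem.eq]
    abel
  have hXD : ∀ n, X n * D = (cayley (h n) - u) * D := by
    intro n
    rw [add_mul, add_mul, hPD, add_zero, add_zero]
  have hXn : ∀ n η, ‖X n η‖ ≤ 4 * ‖η‖ := by
    intro n η
    have hc : cayley (h n) ∈ unitary (K →L[ℂ] K) := cayley_mem_unitary (hh n).2
    have h1 := norm_apply_of_mem_unitary hc η
    have h2 := norm_apply_of_mem_unitary hu η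
    have h3 : ‖P η‖ ≤ ‖η‖ := V.norm_starProjection_apply_le η
    have h4 : X n η = cayley (h n) η - u η + (P η + P η) := by
      simp only [X, add_apply, sub_apply]
    rw [h4]
    refine (norm_add_le_of_le (norm_sub_le _ _) (norm_add_le _ _)).trans ?_
    rw [h1, h2]
    linarith
  have hX0 : Filter.Tendsto (fun n => X n ξ) Filter.atTop (nhds 0) := by
    have hη : ξ - P ξ ∈ closure (Set.range D) := by
      have h1 : ξ - P ξ ∈ Vᗮ := V.sub_starProjection_mem_orthogonal ξ
      have h2 := ContinuousLinearMap.orthogonal_ker D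
      rw [← ContinuousLinearMap.star_eq_adjoint, hsD] at h2
      exact h2.le h1
    have hlim : Filter.Tendsto (fun n => X n * D) Filter.atTop (nhds 0) := by
      refine squeeze_zero_norm (fun n => (hXD n).symm ▸ hn n) ?_
      simpa [div_eq_mul_inv] using (tendsto_one_div_add_atTop_nhds_zero_nat (𝕜 := ℝ)).const_mul 4
    refine (tendsto_zero_of_mem_closure_range hXn hlim hη).congr fun n => ?_
    have := congrArg (fun T : K →L[ℂ] K => T ξ) (hXP n)
    simp only [mul_apply_eq_comp, zero_apply] at this
    rw [map_sub, this, sub_zero]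
  have h1 : ∀ n, cayley (h n) ξ = X n ξ + (u - (P + P)) ξ := by
    intro n
    simp [X]
  simp only [h1]
  simpa using hX0.add_const ((u - (P + P)) ξ)

/-- **Unitary form of Kaplansky's density theorem** for the von Neumann algebra generated by an
increasing net of von Neumann algebras. -/
theorem unitary_mem_strongClosure {ι : Type*} [Preorder ι] [IsDirectedOrder ι] [Nonempty ι]
    {M : ι → VonNeumannAlgebra K} (hM : Monotone M) {u : K →L[ℂ] K}
    (hu : u ∈ unitary (K →L[ℂ] K)) (huM : u ∈ join M) :
    u ∈ strongClosure {v : K →L[ℂ] K | v ∈ unitary (K →L[ℂ] K) ∧ ∃ n, v ∈ M n} := by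
  set G := {v : K →L[ℂ] K | v ∈ unitary (K →L[ℂ] K) ∧ ∃ n, v ∈ M n} with hGdef
  have hdir : ∀ n m, ∃ k, M n ≤ M k ∧ M m ≤ M k := fun n m =>
    let ⟨k, hn, hm⟩ := exists_ge_ge n m
    ⟨k, hM hn, hM hm⟩
  let A : StarSubalgebra ℂ (K →L[ℂ] K) :=
    { carrier := ⋃ n, (M n : Set (K →L[ℂ] K))
      mul_mem' := by
        intro a b ha hb
        obtain ⟨n, ha⟩ := Set.mem_iUnion.1 ha
        obtain ⟨m, hb⟩ := Set.mem_iUnion.1 hb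
        obtain ⟨k, hn, hm⟩ := hdir n m
        exact Set.mem_iUnion.2 ⟨k, mul_mem (hn ha) (hm hb)⟩
      add_mem' := by
        intro a b ha hb
        obtain ⟨n, ha⟩ := Set.mem_iUnion.1 ha
        obtain ⟨m, hb⟩ := Set.mem_iUnion.1 hb
        obtain ⟨k, hn, hm⟩ := hdir n m
        exact Set.mem_iUnion.2 ⟨k, add_mem (hn ha) (hm hb)⟩
      algebraMap_mem' := fun c =>
        Set.mem_iUnion.2 ⟨Classical.arbitrary ι, (M _).toStarSubalgebra.algebraMap_mem c⟩
      star_mem' := by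
        intro a ha
        obtain ⟨n, ha⟩ := Set.mem_iUnion.1 ha
        exact Set.mem_iUnion.2 ⟨n, star_mem ha⟩ }
  have hGmul : ∀ a ∈ G, ∀ b ∈ G, a * b ∈ G := by
    rintro a ⟨ha, n, han⟩ b ⟨hb, m, hbm⟩
    obtain ⟨k, hn, hm⟩ := hdir n m
    exact ⟨mul_mem ha hb, k, mul_mem (hn han) (hm hbm)⟩
  have hcay : ∀ h ∈ join M, star h = h → cayley h ∈ strongClosure G := by
    intro h hh hs
    have h1 := mem_strongClosure_selfAdjoint A
      (centralizer_centralizer_subset_strongClosure A ((mem_join_iff M h).1 hh)) hs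
    refine strongClosure_mono ?_ (cayley_mem_strongClosure hs (fun a ha => ha.2) h1)
    rintro _ ⟨a, ⟨ha, ha'⟩, rfl⟩
    obtain ⟨n, hn⟩ := Set.mem_iUnion.1 ha
    exact ⟨cayley_mem_unitary ha', n, cayley_mem_vonNeumannAlgebra _ hn⟩
  obtain ⟨P, hPM, hPs, hPP, huP, hcl⟩ := sub_add_self_mem_strongClosure_cayley (join M) hu huM
  -- the symmetry `s = 1 - 2 P` satisfies `u = (u s) s` and `u s = u - 2 P`
  have hs2 : (1 - (P + P)) * (1 - (P + P)) = 1 := by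
    simp only [sub_mul, mul_sub, add_mul, mul_add, one_mul, mul_one, hPP]
    abel
  have hss : star (1 - (P + P)) = 1 - (P + P) := by
    simp [hPs]
  have hus : u * (1 - (P + P)) = u - (P + P) := by
    rw [mul_sub, mul_one, mul_add, huP]
  have h1 : u * (1 - (P + P)) ∈ strongClosure G := by
    rw [hus]
    refine strongClosure_idem G (strongClosure_mono ?_ hcl)
    rintro _ ⟨h, ⟨hh, hs⟩, rfl⟩
    exact hcay h hh hs
  have h2 : 1 - (P + P) ∈ strongClosure G := by
    have h3 := hcay _ (sub_mem (one_mem _) (add_mem hPM hPM)) hss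
    have h4 : I • (1 : K →L[ℂ] K) ∈ G := by
      refine ⟨Unitary.mem_iff.2 ⟨?_, ?_⟩, Classical.arbitrary ι,
        smul_mem_vonNeumannAlgebra _ _ (one_mem _)⟩ <;> simp [smul_smul]
    have h5 := mul_mem_strongClosure hGmul (fun a ha ξ => (norm_apply_of_mem_unitary ha.1 ξ).le)
      (subset_strongClosure G h4) h3
    rwa [smul_mul_assoc, one_mul, I_smul_cayley_of_sq_eq_one hss hs2] at h5
  have h3 := mul_mem_strongClosure hGmul (fun a ha ξ => (norm_apply_of_mem_unitary ha.1 ξ).le)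
    h1 h2
  rwa [mul_assoc, hs2, mul_one] at h3

end Unitary

/-! ### Matrices over a von Neumann algebra -/

section MapMatrix

theorem map_map_mul {κ A B : Type*} [Fintype κ] [Semiring A] [StarRing A]
    [Algebra ℂ A] [Semiring B] [StarRing B] [Algebra ℂ B] (f : A →⋆ₐ[ℂ] B)
    (a b : Matrix κ κ A) : (a * b).map f = a.map f * b.map f :=
  Matrix.map_mul (f := (f : A →+* B))

theorem star_map {κ A B : Type*} [Semiring A] [StarRing A]
    [Algebra ℂ A] [Semiring B] [StarRing B] [Algebra ℂ B] (f : A →⋆ₐ[ℂ] B)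
    (a : Matrix κ κ A) : (star a).map f = star (a.map f) := by
  ext i j
  simp [← map_star f]

theorem list_prod_map {κ A B : Type*} [Fintype κ] [DecidableEq κ] [Semiring A] [StarRing A]
    [Algebra ℂ A] [Semiring B] [StarRing B] [Algebra ℂ B] (f : A →⋆ₐ[ℂ] B)
    (L : List (Matrix κ κ A)) : L.prod.map f = (L.map fun a => a.map f).prod :=
  map_list_prod (f : A →+* B).mapMatrix L

end MapMatrix

section MatrixAlgebra

variable {K : Type*} [NormedAddCommGroup K] [InnerProductSpace ℂ K] [CompleteSpace K]
variable {κ : Type*} [Fintype κ] [DecidableEq κ]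

variable (κ) in
/-- The von Neumann algebra `M ⊗ M_κ(ℂ)` on the direct sum of copies of `K`, defined as the
commutant of the diagonal operators with entries in the commutant of `M`. -/
noncomputable def matrixAlgebra (M : VonNeumannAlgebra K) :
    VonNeumannAlgebra (Amplification K κ) where
  toStarSubalgebra := StarSubalgebra.centralizer ℂ (diagOp κ '' M.commutant)
  centralizer_centralizer' := by simp

theorem mem_matrixAlgebra_iff (M : VonNeumannAlgebra K)
    (T : Amplification K κ →L[ℂ] Amplification K κ) :
    T ∈ matrixAlgebra κ M ↔ ∀ i j, (blockOp K κ).symm T i j ∈ M := by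
  have h : T ∈ matrixAlgebra κ M ↔ ∀ c ∈ M.commutant, Commute (diagOp κ c) T := by
    change T ∈ StarSubalgebra.centralizer ℂ _ ↔ _
    rw [StarSubalgebra.mem_centralizer_iff]
    constructor
    · exact fun hT c hc => (hT _ ⟨c, hc, rfl⟩).1
    · rintro hT _ ⟨c, hc, rfl⟩
      refine ⟨hT c hc, ?_⟩
      rw [← diagOp_star]
      exact hT _ (star_mem hc)
  rw [h]
  simp only [commute_diagOp_iff, mem_vonNeumannAlgebra_iff M]
  exact ⟨fun h i j c hc => h c hc i j, fun h c hc i j => h i j c hc⟩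

theorem matrixAlgebra_mono {M M' : VonNeumannAlgebra K} (h : M ≤ M') :
    matrixAlgebra κ M ≤ matrixAlgebra κ M' := fun T hT =>
  (mem_matrixAlgebra_iff M' T).2 fun i j => h ((mem_matrixAlgebra_iff M T).1 hT i j)

/-- An operator commuting with the matrix units and with all `a ⊕ ⋯ ⊕ a`, `a ∈ M n`, has the form
`c ⊕ ⋯ ⊕ c` with `c` commuting with every `M n`. -/
theorem matrixAlgebra_join_le {ι : Type*} [Nonempty ι] (M : ι → VonNeumannAlgebra K) :
    matrixAlgebra κ (join M) ≤ join fun n => matrixAlgebra κ (M n) := by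
  intro T hT
  rw [mem_join_iff, Set.mem_centralizer_iff]
  intro X hX
  rw [Set.mem_centralizer_iff] at hX
  have hsymm : ∀ n (a : Matrix κ κ (K →L[ℂ] K)), (∀ i j, a i j ∈ M n) →
      Commute a ((blockOp K κ).symm X) := by
    intro n a ha
    have h1 : blockOp K κ a ∈ matrixAlgebra κ (M n) := by
      rw [mem_matrixAlgebra_iff]
      simpa using ha
    have h2 := congrArg (blockOp K κ).symm (hX _ (Set.mem_iUnion.2 ⟨n, h1⟩))
    simp only [map_mul, StarAlgEquiv.symm_apply_apply] at h2
    exact h2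
  obtain ⟨c, hc⟩ : (blockOp K κ).symm X ∈ Set.range (Matrix.scalar κ) := by
    refine Matrix.mem_range_scalar_of_commute_single fun i j _ => ?_
    refine hsymm (Classical.arbitrary ι) _ fun i' j' => ?_
    rw [Matrix.single_apply]
    split_ifs
    exacts [one_mem _, zero_mem _]
  have hXc : X = diagOp κ c := by
    rw [diagOp, hc, StarAlgEquiv.apply_symm_apply]
  rw [hXc]
  refine ((commute_diagOp_iff c T).2 fun i j => ?_).eq
  have hT' := (mem_join_iff M _).1 ((mem_matrixAlgebra_iff _ T).1 hT i j)
  refine Set.mem_centralizer_iff.1 hT' c (Set.mem_centralizer_iff.2 fun a ha => ?_)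
  obtain ⟨n, ha⟩ := Set.mem_iUnion.1 ha
  have h1 := hsymm n (Matrix.scalar κ a) fun i' j' => by
    rw [Matrix.scalar_apply, Matrix.diagonal_apply]
    split_ifs
    exacts [ha, zero_mem _]
  rw [← hc, Matrix.scalar_commute_iff, ← Matrix.ext_iff] at h1
  simpa using h1 i i

theorem map_mem_unitary {A B : Type*} [Semiring A] [StarRing A] [Algebra ℂ A] [Semiring B]
    [StarRing B] [Algebra ℂ B] (f : A →⋆ₐ[ℂ] B) {u : Matrix κ κ A}
    (hu : u ∈ unitary (Matrix κ κ A)) : u.map f ∈ unitary (Matrix κ κ B) := by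
  have h1 : (1 : Matrix κ κ A).map f = 1 := Matrix.map_one f (map_zero f) (map_one f)
  rw [Unitary.mem_iff] at hu ⊢
  rw [← star_map, ← map_map_mul, ← map_map_mul, hu.1, hu.2, h1]
  exact ⟨rfl, rfl⟩

theorem mem_unitary_of_map {A B : Type*} [Semiring A] [StarRing A] [Algebra ℂ A] [Semiring B]
    [StarRing B] [Algebra ℂ B] (f : A →⋆ₐ[ℂ] B) (hf : Function.Injective f) {u : Matrix κ κ A}
    (hu : u.map f ∈ unitary (Matrix κ κ B)) : u ∈ unitary (Matrix κ κ A) := by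
  have h1 : (1 : Matrix κ κ A).map f = 1 := Matrix.map_one f (map_zero f) (map_one f)
  rw [Unitary.mem_iff] at hu ⊢
  rw [← star_map, ← map_map_mul, ← map_map_mul, ← h1] at hu
  exact ⟨Matrix.map_injective hf hu.1, Matrix.map_injective hf hu.2⟩

theorem blockOp_mem_unitary_iff {a : Matrix κ κ (K →L[ℂ] K)} :
    blockOp K κ a ∈ unitary (Amplification K κ →L[ℂ] Amplification K κ) ↔
      a ∈ unitary (Matrix κ κ (K →L[ℂ] K)) := by
  rw [Unitary.mem_iff, Unitary.mem_iff, ← map_star, ← map_mul, ← map_mul, ← map_one (blockOp K κ),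
    EmbeddingLike.apply_eq_iff_eq, EmbeddingLike.apply_eq_iff_eq]

theorem norm_entry_apply_le_of_mem_unitary {M : VonNeumannAlgebra K}
    {u : Matrix κ κ M.toStarSubalgebra} (hu : u ∈ unitary (Matrix κ κ M.toStarSubalgebra))
    (i j : κ) (ξ : K) : ‖(u i j : K →L[ℂ] K) ξ‖ ≤ ‖ξ‖ := by
  have h1 := blockOp_mem_unitary_iff.2 (map_mem_unitary M.toStarSubalgebra.subtype hu)
  have h2 := norm_apply_of_mem_unitary h1 (PiLp.single 2 j ξ)
  have h3 := PiLp.norm_apply_le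
    (blockOp K κ (u.map M.toStarSubalgebra.subtype) (PiLp.single 2 j ξ)) i
  rw [h2, PiLp.norm_single, ← blockOp_symm_apply, StarAlgEquiv.symm_apply_apply] at h3
  exact h3

/-- The entries of the matrices `v t` converge strongly to those of `u` along the filter `l`. -/
def EntrywiseTendsto {M : VonNeumannAlgebra K} {α : Type*} (l : Filter α)
    (v : α → Matrix κ κ M.toStarSubalgebra) (u : Matrix κ κ M.toStarSubalgebra) : Prop :=
  ∀ i j ξ, Filter.Tendsto (fun t => (v t i j : K →L[ℂ] K) ξ) l (nhds ((u i j : K →L[ℂ] K) ξ))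

/-- Every unitary matrix over the von Neumann algebra generated by an increasing net is a limit of
unitary matrices over the members of the net. -/
theorem exists_filter_entrywiseTendsto {ι : Type*} [Preorder ι] [IsDirectedOrder ι] [Nonempty ι]
    {M : ι → VonNeumannAlgebra K} (hM : Monotone M) {N : VonNeumannAlgebra K} (hN : N = join M)
    (hle : ∀ n, M n ≤ N) {u : Matrix κ κ N.toStarSubalgebra}
    (hu : u ∈ unitary (Matrix κ κ N.toStarSubalgebra)) :
    ∃ l : Filter (Matrix κ κ N.toStarSubalgebra), l.NeBot ∧
      (∀ᶠ v in l, v ∈ unitary (Matrix κ κ N.toStarSubalgebra) ∧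
        ∃ n, ∃ w ∈ unitary (Matrix κ κ (M n).toStarSubalgebra), v = w.map (incl (hle n))) ∧
      EntrywiseTendsto l id u := by
  classical
  have h1 := blockOp_mem_unitary_iff.2 (map_mem_unitary N.toStarSubalgebra.subtype hu)
  set U := blockOp K κ (u.map N.toStarSubalgebra.subtype) with hU
  have hUM : U ∈ join fun n => matrixAlgebra κ (M n) := by
    refine matrixAlgebra_join_le M ?_
    rw [mem_matrixAlgebra_iff, hU, StarAlgEquiv.symm_apply_apply, ← hN]
    exact fun i j => (u i j).2
  obtain ⟨l, hl, hG, hlim⟩ := exists_filter_of_mem_strongClosure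
    (unitary_mem_strongClosure (fun n m h => matrixAlgebra_mono (hM h)) h1 hUM)
  -- the matrix of an operator; the default value `0` is not used along the filter
  let f : (Amplification K κ →L[ℂ] Amplification K κ) → Matrix κ κ N.toStarSubalgebra :=
    fun T i j => if h : (blockOp K κ).symm T i j ∈ N then ⟨_, h⟩ else 0
  have hf : ∀ n, ∀ T ∈ matrixAlgebra κ (M n), ∀ i j,
      (f T i j : K →L[ℂ] K) = (blockOp K κ).symm T i j := by
    intro n T hT i j
    have : (blockOp K κ).symm T i j ∈ N := hle n ((mem_matrixAlgebra_iff _ T).1 hT i j)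
    simp only [f, dif_pos this]
  refine ⟨Filter.map f l, inferInstance, ?_, ?_⟩
  · rw [Filter.eventually_map]
    filter_upwards [hG] with T hT
    obtain ⟨hTu, n, hn⟩ := hT
    have hTu' : (blockOp K κ).symm T ∈ unitary (Matrix κ κ (K →L[ℂ] K)) := by
      rwa [← blockOp_mem_unitary_iff, StarAlgEquiv.apply_symm_apply]
    let w : Matrix κ κ (M n).toStarSubalgebra :=
      fun i j => ⟨_, (mem_matrixAlgebra_iff _ T).1 hn i j⟩
    have hw : w ∈ unitary (Matrix κ κ (M n).toStarSubalgebra) :=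
      mem_unitary_of_map (M n).toStarSubalgebra.subtype Subtype.val_injective hTu'
    have hfw : f T = w.map (incl (hle n)) :=
      Matrix.ext fun i j => Subtype.ext (hf n T hn i j)
    exact ⟨hfw ▸ map_mem_unitary (incl (hle n)) hw, n, w, hw, hfw⟩
  · intro i j ξ
    rw [Filter.tendsto_map'_iff]
    have h2 : Filter.Tendsto (fun T : Amplification K κ →L[ℂ] Amplification K κ =>
        T (PiLp.single 2 j ξ) i) l (nhds (U (PiLp.single 2 j ξ) i)) :=
      ((PiLp.proj 2 (fun _ : κ => K) i : Amplification K κ →L[ℂ] K).continuous.tendsto _).comp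
        (hlim (PiLp.single 2 j ξ))
    rw [← blockOp_symm_apply, hU, StarAlgEquiv.symm_apply_apply] at h2
    refine h2.congr' ?_
    filter_upwards [hG] with T hT
    obtain ⟨hTu, n, hn⟩ := hT
    simp only [Function.comp_apply, id]
    rw [hf n T hn, blockOp_symm_apply]

/-- Only the left factors need to be bounded for products to converge strongly. -/
theorem EntrywiseTendsto.mul {M : VonNeumannAlgebra K} {α : Type*} {l : Filter α}
    {v w : α → Matrix κ κ M.toStarSubalgebra} {u t : Matrix κ κ M.toStarSubalgebra}
    (hv : EntrywiseTendsto l v u) (hw : EntrywiseTendsto l w t)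
    (hvu : ∀ᶠ x in l, v x ∈ unitary (Matrix κ κ M.toStarSubalgebra)) :
    EntrywiseTendsto l (fun x => v x * w x) (u * t) := by
  intro i j ξ
  have h : ∀ a b : Matrix κ κ M.toStarSubalgebra, ((a * b) i j : K →L[ℂ] K) ξ =
      ∑ k, (a i k : K →L[ℂ] K) ((b k j : K →L[ℂ] K) ξ) := by
    intro a b
    rw [Matrix.mul_apply, AddSubmonoidClass.coe_finsetSum, sum_apply]
    rfl
  simp only [h]
  refine tendsto_finsetSum _ fun k _ => ?_
  have h1 : Filter.Tendsto (fun x => (v x i k : K →L[ℂ] K)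
      ((w x k j : K →L[ℂ] K) ξ - (t k j : K →L[ℂ] K) ξ)) l (nhds 0) := by
    refine squeeze_zero_norm' ?_ (tendsto_iff_norm_sub_tendsto_zero.1 (hw k j ξ))
    filter_upwards [hvu] with x hx
    exact norm_entry_apply_le_of_mem_unitary hx i k _
  have h2 := h1.add (hv i k ((t k j : K →L[ℂ] K) ξ))
  rw [zero_add] at h2
  refine h2.congr fun x => ?_
  rw [map_sub, sub_add_cancel]

theorem EntrywiseTendsto.list_prod {M : VonNeumannAlgebra K} {α β : Type*} {l : Filter α}
    (L : List β) (v : β → α → Matrix κ κ M.toStarSubalgebra)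
    (u : β → Matrix κ κ M.toStarSubalgebra) (h : ∀ b, EntrywiseTendsto l (v b) (u b))
    (hvu : ∀ b, ∀ᶠ x in l, v b x ∈ unitary (Matrix κ κ M.toStarSubalgebra)) :
    EntrywiseTendsto l (fun x => (L.map fun b => v b x).prod) (L.map u).prod := by
  induction L with
  | nil =>
    intro i j ξ
    exact tendsto_const_nhds
  | cons b L ih =>
    simp only [List.map_cons, List.prod_cons]
    exact (h b).mul ih (hvu b)

end MatrixAlgebra

/-! ### Positive functionals and normal states on matrix algebras -/

/-- The Cauchy-Schwarz inequality for the GNS representation of a positive functional. -/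
theorem norm_apply_star_mul_mul_le {B : Type*} [CStarAlgebra B] (f : B →ₗ[ℂ] ℂ)
    (hf : ∀ a, 0 ≤ f (star a * a)) (x a y : B) :
    ‖f (star x * a * y)‖ ≤ √(f (star x * x)).re * (‖a‖ * √(f (star y * y)).re) := by
  let : PartialOrder B := CStarAlgebra.spectralOrder B
  have : StarOrderedRing B := CStarAlgebra.spectralOrderedRing B
  let g : B →ₚ[ℂ] ℂ := PositiveLinearMap.mk₀ f fun b hb => by
    obtain ⟨c, rfl⟩ := CStarAlgebra.nonneg_iff_eq_star_mul_self.1 hb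
    exact hf c
  have h1 : ‖g.leftMulMapPreGNS a‖ ≤ ‖a‖ := LinearMap.mkContinuous_norm_le _ (norm_nonneg _) _
  have h2 := ContinuousLinearMap.le_of_opNorm_le _ h1 (g.toPreGNS y)
  have h3 := norm_inner_le_norm (𝕜 := ℂ) (g.toPreGNS x) (g.leftMulMapPreGNS a (g.toPreGNS y))
  have h4 : inner ℂ (g.toPreGNS x) (g.leftMulMapPreGNS a (g.toPreGNS y)) =
      f (star x * a * y) := by
    rw [PositiveLinearMap.preGNS_inner_def, mul_assoc]
    rfl
  rw [h4] at h3
  exact h3.trans (mul_le_mul_of_nonneg_left h2 (norm_nonneg _))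

section GNS

variable {H : Type*} [NormedAddCommGroup H] [InnerProductSpace ℂ H] [CompleteSpace H]

/-- The same inequality on `M ⊗ M_κ(ℂ)`. The norm of operator matrices over `B(H)` restricts to the
C⋆-norm of matrices over `M` because injective `*`-homomorphisms are isometric. -/
theorem norm_matrix_apply_star_mul_mul_le {M : VonNeumannAlgebra H} {κ : Type*} [Fintype κ]
    [DecidableEq κ] (f : Matrix κ κ M.toStarSubalgebra →ₗ[ℂ] ℂ)
    (hf : ∀ a, 0 ≤ f (star a * a)) (x a y : Matrix κ κ M.toStarSubalgebra) :
    ‖f (star x * a * y)‖ ≤ √(f (star x * x)).re * (matNorm a * √(f (star y * y)).re) := by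
  have hcl : IsClosed (M.toStarSubalgebra : Set (H →L[ℂ] H)) := isClosed_vonNeumannAlgebra M
  let : PartialOrder M.toStarSubalgebra := CStarAlgebra.spectralOrder _
  have : StarOrderedRing M.toStarSubalgebra := CStarAlgebra.spectralOrderedRing _
  let g : M.toStarSubalgebra →⋆ₙₐ[ℂ] (H →L[ℂ] H) := (M.toStarSubalgebra.subtype : _ →⋆ₐ[ℂ] _)
  let G : CStarMatrix κ κ M.toStarSubalgebra →⋆ₙₐ[ℂ] CStarMatrix κ κ (H →L[ℂ] H) :=
    CStarMatrix.mapₙₐ g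
  have hG : Function.Injective G := CStarMatrix.map_injective Subtype.val_injective
  have hn : matNorm a = ‖(CStarMatrix.ofMatrix a : CStarMatrix κ κ M.toStarSubalgebra)‖ := by
    rw [← NonUnitalStarAlgHom.norm_map G hG]
    rfl
  rw [hn]
  exact norm_apply_star_mul_mul_le (B := CStarMatrix κ κ M.toStarSubalgebra) f hf x a y

end GNS

section Functionals

variable {H : Type*} [NormedAddCommGroup H] [InnerProductSpace ℂ H] [CompleteSpace H]
variable {M : VonNeumannAlgebra H} {κ : Type*} [Fintype κ]

theorem functionalNorm_add_le (f g : Matrix κ κ M.toStarSubalgebra →ₗ[ℂ] ℂ) :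
    functionalNorm (f + g) ≤ functionalNorm f + functionalNorm g := by
  refine iSup₂_le fun a ha => (enorm_add_le (f a) (g a)).trans (add_le_add ?_ ?_)
  · exact le_iSup₂ (f := fun a (_ : matNorm a ≤ 1) => ‖f a‖ₑ) a ha
  · exact le_iSup₂ (f := fun a (_ : matNorm a ≤ 1) => ‖g a‖ₑ) a ha

theorem functionalNorm_le {f : Matrix κ κ M.toStarSubalgebra →ₗ[ℂ] ℂ} {C : ℝ}
    (h : ∀ a, matNorm a ≤ 1 → ‖f a‖ ≤ C) : functionalNorm f ≤ ENNReal.ofReal C :=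
  iSup₂_le fun a ha => by
    rw [← ofReal_norm]
    exact ENNReal.ofReal_le_ofReal (h a ha)

theorem conjFunctional_apply [DecidableEq κ] (u : Matrix κ κ M.toStarSubalgebra)
    (f : Matrix κ κ M.toStarSubalgebra →ₗ[ℂ] ℂ) (a : Matrix κ κ M.toStarSubalgebra) :
    conjFunctional u f a = f (star u * (a * u)) := rfl

theorem tensorVectorState_apply (ω : NormalState M) (φ : EuclideanSpace ℂ κ)
    (a : Matrix κ κ M.toStarSubalgebra) :
    tensorVectorState ω φ a = ∑ i, ∑ j, star (φ i) * ω.functional (a i j) * φ j := rfl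

/-- With `b k = ∑ j, φ j • a k j`, the value of `ω ⊗ φ` at `a* a` is `∑ k, ω ((b k)* (b k))`. -/
theorem tensorVectorState_nonneg (ω : NormalState M) (φ : EuclideanSpace ℂ κ)
    (a : Matrix κ κ M.toStarSubalgebra) : 0 ≤ tensorVectorState ω φ (star a * a) := by
  have h : tensorVectorState ω φ (star a * a) =
      ∑ k, ω.functional (star (∑ i, φ i • a k i) * ∑ j, φ j • a k j) := by
    simp only [tensorVectorState_apply, Matrix.mul_apply, Matrix.star_apply, star_sum, star_smul,
      Finset.sum_mul, Finset.mul_sum, map_sum, smul_mul_assoc, mul_smul_comm, map_smul,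
      smul_eq_mul]
    rw [Finset.sum_comm_cycle]
    refine Finset.sum_congr rfl fun k _ => ?_
    rw [Finset.sum_comm]
    refine Finset.sum_congr rfl fun i _ => Finset.sum_congr rfl fun j _ => ?_
    ring
  rw [h]
  exact Finset.sum_nonneg fun k _ => ω.nonneg _

theorem tensorVectorState_one [DecidableEq κ] (ω : NormalState M) (φ : EuclideanSpace ℂ κ) :
    tensorVectorState ω φ 1 = (‖φ‖ : ℂ) ^ 2 := by
  have h : ∀ i, ∑ j, star (φ i) * ω.functional ((1 : Matrix κ κ M.toStarSubalgebra) i j) * φ j =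
      star (φ i) * φ i := by
    intro i
    rw [Finset.sum_eq_single i]
    · rw [Matrix.one_apply_eq, ω.map_one, mul_one]
    · intro j _ hj
      rw [Matrix.one_apply_ne hj.symm, map_zero, mul_zero, zero_mul]
    · simp
  rw [tensorVectorState_apply, Finset.sum_congr rfl fun i _ => h i, ← Complex.ofReal_pow,
    EuclideanSpace.norm_sq_eq, Complex.ofReal_sum]
  refine Finset.sum_congr rfl fun i _ => ?_
  rw [Complex.star_def, ← Complex.normSq_eq_conj_mul_self, Complex.normSq_eq_norm_sq]

theorem NormalState.norm_apply_le (ω : NormalState M) (a : M.toStarSubalgebra) :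
    ‖ω.functional a‖ ≤ ‖(a : H →L[ℂ] H)‖ := by
  have : IsClosed (M.toStarSubalgebra : Set (H →L[ℂ] H)) := isClosed_vonNeumannAlgebra M
  have h := norm_apply_star_mul_mul_le (B := M.toStarSubalgebra) ω.functional ω.nonneg 1 a 1
  simpa [ω.map_one] using h

/-- Conjugation with two unitaries that are close in the seminorm `a ↦ f (a* a) ^ (1/2)` leads to
functionals that are close in norm. -/
theorem functionalNorm_conjFunctional_sub_le [DecidableEq κ]
    (f : Matrix κ κ M.toStarSubalgebra →ₗ[ℂ] ℂ) (hf : ∀ a, 0 ≤ f (star a * a)) (hf1 : f 1 = 1)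
    {u v : Matrix κ κ M.toStarSubalgebra} (hu : u ∈ unitary (Matrix κ κ M.toStarSubalgebra))
    (hv : v ∈ unitary (Matrix κ κ M.toStarSubalgebra)) :
    functionalNorm (conjFunctional v f - conjFunctional u f) ≤
      ENNReal.ofReal (2 * √(f (star (v - u) * (v - u))).re) := by
  refine functionalNorm_le fun a ha => ?_
  have h : (conjFunctional v f - conjFunctional u f) a =
      f (star (v - u) * a * v) + f (star u * a * (v - u)) := by
    rw [LinearMap.sub_apply, conjFunctional_apply, conjFunctional_apply, ← map_sub, ← map_add]
    congr 1
    simp only [star_sub, sub_mul, mul_sub, mul_assoc]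
    abel
  have h1 := norm_matrix_apply_star_mul_mul_le f hf (v - u) a v
  have h2 := norm_matrix_apply_star_mul_mul_le f hf u a (v - u)
  rw [(Unitary.mem_iff.1 hv).1, hf1] at h1
  rw [(Unitary.mem_iff.1 hu).1, hf1] at h2
  simp only [Complex.one_re, Real.sqrt_one, mul_one, one_mul] at h1 h2
  rw [h]
  refine (norm_add_le_of_le h1 h2).trans ?_
  have h3 := Real.sqrt_nonneg (f (star (v - u) * (v - u))).re
  nlinarith

theorem norm_entry_le_matNorm (a : Matrix κ κ M.toStarSubalgebra) (i j : κ) :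
    ‖(a i j : H →L[ℂ] H)‖ ≤ matNorm a :=
  CStarMatrix.norm_entry_le_norm
    (M := CStarMatrix.ofMatrix (a.map (fun b => (b : H →L[ℂ] H)))) (i := i) (j := j)

theorem matNorm_conj_le [DecidableEq κ] {u : Matrix κ κ M.toStarSubalgebra}
    (hu : u ∈ unitary (Matrix κ κ M.toStarSubalgebra)) (a : Matrix κ κ M.toStarSubalgebra) :
    matNorm (star u * (a * u)) ≤ matNorm a := by
  let G : Matrix κ κ M.toStarSubalgebra → CStarMatrix κ κ (H →L[ℂ] H) := fun a =>
    CStarMatrix.ofMatrix (a.map (fun b => (b : H →L[ℂ] H)))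
  have hG : G u ∈ unitary (CStarMatrix κ κ (H →L[ℂ] H)) :=
    map_mem_unitary M.toStarSubalgebra.subtype hu
  have hGm : ∀ a b, G (a * b) = G a * G b := fun a b =>
    Matrix.map_mul (f := (M.toStarSubalgebra.subtype : M.toStarSubalgebra →+* (H →L[ℂ] H)))
  have hGs : G (star u) = star (G u) := rfl
  have h1 := norm_le_one_of_mem_unitary hG
  have h2 : ‖star (G u)‖ ≤ 1 := (norm_star (G u)).trans_le h1
  change ‖G (star u * (a * u))‖ ≤ ‖G a‖
  rw [hGm, hGm, hGs]
  calc _ ≤ 1 * (‖G a‖ * 1) := norm_mul_le_of_le h2 (norm_mul_le_of_le le_rfl h1)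
    _ = ‖G a‖ := by ring

theorem functionalNorm_conjFunctional_le [DecidableEq κ] {u : Matrix κ κ M.toStarSubalgebra}
    (hu : u ∈ unitary (Matrix κ κ M.toStarSubalgebra))
    (f : Matrix κ κ M.toStarSubalgebra →ₗ[ℂ] ℂ) :
    functionalNorm (conjFunctional u f) ≤ functionalNorm f :=
  iSup₂_le fun a ha => le_iSup₂ (f := fun a (_ : matNorm a ≤ 1) => ‖f a‖ₑ) _
    ((matNorm_conj_le hu a).trans ha)

theorem functionalNorm_tensorVectorState_sub_le (ω : NormalState M) (φ φ' : EuclideanSpace ℂ κ) :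
    functionalNorm (tensorVectorState ω φ - tensorVectorState ω φ') ≤
      ENNReal.ofReal (∑ i, ∑ j, ‖star (φ i) * φ j - star (φ' i) * φ' j‖) := by
  refine functionalNorm_le fun a ha => ?_
  rw [LinearMap.sub_apply, tensorVectorState_apply, tensorVectorState_apply,
    ← Finset.sum_sub_distrib]
  refine norm_sum_le_of_le _ fun i _ => ?_
  rw [← Finset.sum_sub_distrib]
  refine norm_sum_le_of_le _ fun j _ => ?_
  have h1 : ‖ω.functional (a i j)‖ ≤ 1 :=
    (ω.norm_apply_le _).trans ((norm_entry_le_matNorm a i j).trans ha)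
  have h2 : star (φ i) * ω.functional (a i j) * φ j - star (φ' i) * ω.functional (a i j) * φ' j =
      (star (φ i) * φ j - star (φ' i) * φ' j) * ω.functional (a i j) := by ring
  rw [h2, norm_mul]
  exact mul_le_of_le_one_right (norm_nonneg _) h1

/-- A normal state vanishes in the limit along nets on which all functionals defining the
ultraweak topology do. -/
theorem NormalState.tendsto_zero (ω : NormalState M) {α : Type*} {l : Filter α}
    {b : α → M.toStarSubalgebra}
    (h : ∀ ξ η : ℕ → H, (Summable fun k => ‖ξ k‖ ^ 2) → (Summable fun k => ‖η k‖ ^ 2) →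
      Filter.Tendsto (fun t => ∑' k, inner ℂ (ξ k) ((b t : H →L[ℂ] H) (η k))) l (nhds 0)) :
    Filter.Tendsto (fun t => ω.functional (b t)) l (nhds 0) := by
  have h1 : Filter.Tendsto ω.functional (@nhds _ (ultraweakOn M) 0) (nhds 0) := by
    have := (@Continuous.tendsto _ _ (ultraweakOn M) _ _ ω.normal) 0
    rwa [map_zero] at this
  refine h1.comp ?_
  have h2 : @nhds _ (ultraweakOn M) 0 =
      Filter.comap Subtype.val (@nhds _ (ultraweakTopology H) (0 : H →L[ℂ] H)) :=
    @nhds_induced _ _ (ultraweakTopology H) _ _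
  rw [h2, Filter.tendsto_comap_iff, ultraweakTopology]
  simp only [nhds_iInf, Filter.tendsto_iInf, nhds_induced, Filter.tendsto_comap_iff]
  intro ξ η hξ hη
  simpa [Function.comp_def] using h ξ η hξ hη

/-- By dominated convergence, `ω (a* c)` tends to zero when `a` and `c` tend to zero strongly and
boundedly. -/
theorem NormalState.tendsto_star_mul_zero (ω : NormalState M) {α : Type*} {l : Filter α}
    {a c : α → M.toStarSubalgebra} {C : ℝ}
    (ha : ∀ ξ, Filter.Tendsto (fun t => (a t : H →L[ℂ] H) ξ) l (nhds 0))
    (hc : ∀ ξ, Filter.Tendsto (fun t => (c t : H →L[ℂ] H) ξ) l (nhds 0))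
    (ha' : ∀ᶠ t in l, ∀ ξ, ‖(a t : H →L[ℂ] H) ξ‖ ≤ C * ‖ξ‖)
    (hc' : ∀ᶠ t in l, ∀ ξ, ‖(c t : H →L[ℂ] H) ξ‖ ≤ C * ‖ξ‖) :
    Filter.Tendsto (fun t => ω.functional (star (a t) * c t)) l (nhds 0) := by
  refine ω.tendsto_zero fun ξ η hξ hη => ?_
  have hin : ∀ t k, inner ℂ (ξ k) (((star (a t) * c t : M.toStarSubalgebra) : H →L[ℂ] H) (η k)) =
      inner ℂ ((a t : H →L[ℂ] H) (ξ k)) ((c t : H →L[ℂ] H) (η k)) := by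
    intro t k
    have : ((star (a t) * c t : M.toStarSubalgebra) : H →L[ℂ] H) (η k) =
      star (a t : H →L[ℂ] H) ((c t : H →L[ℂ] H) (η k)) := rfl
    rw [this, ContinuousLinearMap.star_eq_adjoint, ContinuousLinearMap.adjoint_inner_right]
  simp only [hin]
  have hlim := tendsto_tsum_of_dominated_convergence (𝓕 := l)
    (f := fun t k => inner ℂ ((a t : H →L[ℂ] H) (ξ k)) ((c t : H →L[ℂ] H) (η k)))
    (g := fun _ => (0 : ℂ)) (bound := fun k => C ^ 2 * (‖ξ k‖ ^ 2 + ‖η k‖ ^ 2))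
    ((hξ.add hη).mul_left _) (fun k => by simpa using (ha (ξ k)).inner (hc (η k)) (𝕜 := ℂ)) ?_
  · simpa using hlim
  · filter_upwards [ha', hc'] with t hat hct k
    refine (norm_inner_le_norm _ _).trans ((mul_le_mul (hat _) (hct _) (norm_nonneg _)
      ((norm_nonneg _).trans (hat _))).trans ?_)
    nlinarith [mul_nonneg (sq_nonneg C) (sq_nonneg (‖ξ k‖ - ‖η k‖)),
      mul_nonneg (sq_nonneg C) (add_nonneg (sq_nonneg ‖ξ k‖) (sq_nonneg ‖η k‖))]

/-- Strong convergence of unitaries implies convergence in the seminorm given by `ω ⊗ φ`. -/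
theorem tendsto_tensorVectorState_star_mul [DecidableEq κ] (ω : NormalState M)
    (φ : EuclideanSpace ℂ κ) {α : Type*} {l : Filter α} {v : α → Matrix κ κ M.toStarSubalgebra}
    {u : Matrix κ κ M.toStarSubalgebra} (hu : u ∈ unitary (Matrix κ κ M.toStarSubalgebra))
    (hv : ∀ᶠ t in l, v t ∈ unitary (Matrix κ κ M.toStarSubalgebra))
    (h : EntrywiseTendsto l v u) :
    Filter.Tendsto (fun t => tensorVectorState ω φ (star (v t - u) * (v t - u))) l (nhds 0) := by
  have hc : ∀ i j ξ, Filter.Tendsto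
      (fun t => (((v t - u) i j : M.toStarSubalgebra) : H →L[ℂ] H) ξ) l (nhds 0) := by
    intro i j ξ
    simpa using (h i j ξ).sub_const ((u i j : H →L[ℂ] H) ξ)
  have hb : ∀ i j, ∀ᶠ t in l, ∀ ξ,
      ‖(((v t - u) i j : M.toStarSubalgebra) : H →L[ℂ] H) ξ‖ ≤ 2 * ‖ξ‖ := by
    intro i j
    filter_upwards [hv] with t ht ξ
    have h1 := norm_entry_apply_le_of_mem_unitary ht i j ξ
    have h2 := norm_entry_apply_le_of_mem_unitary hu i j ξ
    have h3 : (((v t - u) i j : M.toStarSubalgebra) : H →L[ℂ] H) ξ =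
      (v t i j : H →L[ℂ] H) ξ - (u i j : H →L[ℂ] H) ξ := rfl
    rw [h3]
    linarith [norm_sub_le ((v t i j : H →L[ℂ] H) ξ) ((u i j : H →L[ℂ] H) ξ)]
  have hlim : ∀ i j, Filter.Tendsto (fun t => ω.functional ((star (v t - u) * (v t - u)) i j)) l
      (nhds 0) := by
    intro i j
    simp only [Matrix.mul_apply, Matrix.star_apply, map_sum]
    simpa using tendsto_finsetSum (a := fun _ => (0 : ℂ)) Finset.univ fun k _ =>
      ω.tendsto_star_mul_zero (hc k i) (hc k j) (hb k i) (hb k j)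
  have hterm : ∀ i j, Filter.Tendsto (fun t => star (φ i) *
      ω.functional ((star (v t - u) * (v t - u)) i j) * φ j) l (nhds 0) := fun i j => by
    simpa only [mul_zero, zero_mul] using ((hlim i j).const_mul (star (φ i))).mul_const (φ j)
  have hsum := tendsto_finsetSum Finset.univ fun i (_ : i ∈ Finset.univ) =>
    tendsto_finsetSum Finset.univ fun j (_ : j ∈ Finset.univ) => hterm i j
  simpa only [Finset.sum_const_zero, tensorVectorState_apply] using hsum

end Functionals

/-! ### Matrices acting on one tensor factor -/

section AtParty

variable {R : Type*} {N d : ℕ}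

theorem atParty_map {R' : Type*} [Zero R] [Zero R'] (f : R → R') (hf : f 0 = 0) (x : Fin N)
    (u : Matrix (Fin d) (Fin d) R) : (atParty x u).map f = atParty x (u.map f) := by
  ext i j
  simp only [atParty, Matrix.map_apply, Matrix.of_apply]
  split_ifs <;> simp [hf]

theorem atParty_one [Semiring R] (x : Fin N) :
    atParty x (1 : Matrix (Fin d) (Fin d) R) = 1 := by
  ext i j
  simp only [atParty, Matrix.of_apply, Matrix.one_apply]
  by_cases hij : i = j
  · subst hij
    simp
  · rw [if_neg hij]
    split_ifs with h1 h2
    · exact absurd (funext fun y => if hy : y = x then hy ▸ h2 else h1 y hy) hij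
    · rfl
    · rfl

theorem atParty_mul [Semiring R] (x : Fin N) (u v : Matrix (Fin d) (Fin d) R) :
    atParty x (u * v) = atParty x u * atParty x v := by
  ext i j
  simp only [atParty, Matrix.of_apply, Matrix.mul_apply]
  -- only the indices agreeing with `i` off `x` contribute to the sum
  rw [← Finset.sum_subset (Finset.subset_univ
    (Finset.univ.image fun c : Fin d => Function.update i x c))]
  · rw [Finset.sum_image fun a _ b _ h => by simpa using congrFun h x]
    split_ifs with h
    · refine Finset.sum_congr rfl fun c _ => ?_
      rw [if_pos fun y hy => by simp [hy], if_pos fun y hy => by simp [hy, h y hy]]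
      simp
    · symm
      refine Finset.sum_eq_zero fun c _ => ?_
      rw [if_neg (c := ∀ y, y ≠ x → Function.update i x c y = j y), mul_zero]
      exact fun h' => h fun y hy => by simpa [hy] using h' y hy
  · intro k _ hk
    rw [if_neg, zero_mul]
    intro h
    refine hk (Finset.mem_image.2 ⟨k x, Finset.mem_univ _, ?_⟩)
    ext1 y
    by_cases hy : y = x
    · subst hy
      simp
    · simp [hy, h y hy]

theorem atParty_star [Semiring R] [StarRing R] (x : Fin N) (u : Matrix (Fin d) (Fin d) R) :
    atParty x (star u) = star (atParty x u) := by
  ext i j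
  simp only [atParty, Matrix.of_apply, Matrix.star_apply, apply_ite star, star_zero,
    eq_comm (a := i _)]

theorem atParty_mem_unitary [Semiring R] [StarRing R] (x : Fin N)
    {u : Matrix (Fin d) (Fin d) R} (hu : u ∈ unitary (Matrix (Fin d) (Fin d) R)) :
    atParty x u ∈ unitary (Matrix (Fin N → Fin d) (Fin N → Fin d) R) := by
  rw [Unitary.mem_iff] at hu ⊢
  rw [← atParty_star, ← atParty_mul, ← atParty_mul, hu.1, hu.2, atParty_one]
  exact ⟨rfl, rfl⟩

end AtParty

/-! ### Increasing nets of multipartite systems -/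

section Net

variable {ι : Type*} [Preorder ι] {N : ℕ} {H : Type*} [NormedAddCommGroup H]
  [InnerProductSpace ℂ H] [CompleteSpace H]

theorem IncreasingNet.Generates.party_le {T : IncreasingNet ι N H} {S : NPartiteSystem N H}
    (h : T.Generates S) (n : ι) (x : Fin N) : (T.stage n).party x ≤ S.party x := by
  rw [h x]
  exact le_join (fun n => (T.stage n).party x) n

theorem matNorm_map_incl {κ : Type*} [Fintype κ] {A B : VonNeumannAlgebra H} (h : A ≤ B)
    (a : Matrix κ κ A.toStarSubalgebra) : matNorm (a.map (incl h)) = matNorm a := by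
  have : (a.map (incl h)).map (fun b => (b : H →L[ℂ] H)) = a.map (fun b => (b : H →L[ℂ] H)) := by
    ext1 i j
    rfl
  rw [matNorm, matNorm, this]

theorem functionalNorm_le_functionalNorm {κ : Type*} [Fintype κ] {A B : VonNeumannAlgebra H}
    (h : A ≤ B) {f : Matrix κ κ A.toStarSubalgebra →ₗ[ℂ] ℂ}
    {g : Matrix κ κ B.toStarSubalgebra →ₗ[ℂ] ℂ} (hfg : ∀ a, f a = g (a.map (incl h))) :
    functionalNorm f ≤ functionalNorm g := by
  refine iSup₂_le fun a ha => ?_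
  rw [hfg a]
  exact le_iSup₂ (f := fun b (_ : matNorm b ≤ 1) => ‖g b‖ₑ) (a.map (incl h))
    ((matNorm_map_incl h a).trans_le ha)

/-- Local elements at the stage `n`, regarded as local elements of the generated system. -/
noncomputable def IncreasingNet.Generates.lift {T : IncreasingNet ι N H} {S : NPartiteSystem N H}
    (h : T.Generates S) {n : ι} {d : ℕ} (u : (T.stage n).LocalFamily d) : S.LocalFamily d :=
  fun x => (u x).map (incl (h.party_le n x))

theorem IncreasingNet.Generates.lift_transport {T : IncreasingNet ι N H} {S : NPartiteSystem N H}
    (h : T.Generates S) {n m : ι} (hnm : n ≤ m) {d : ℕ} (u : (T.stage n).LocalFamily d) :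
    h.lift (T.transport hnm u) = h.lift u := rfl

theorem IncreasingNet.Generates.lift_mem_unitary {T : IncreasingNet ι N H}
    {S : NPartiteSystem N H} (h : T.Generates S) {n : ι} {d : ℕ}
    {u : (T.stage n).LocalFamily d} (hu : ∀ x, u x ∈ unitary _) (x : Fin N) :
    h.lift u x ∈ unitary _ := map_mem_unitary _ (hu x)

theorem IncreasingNet.transport_mem_unitary (T : IncreasingNet ι N H) {n m : ι} (hnm : n ≤ m)
    {d : ℕ} {u : (T.stage n).LocalFamily d} (hu : ∀ x, u x ∈ unitary _) (x : Fin N) :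
    T.transport hnm u x ∈ unitary _ := map_mem_unitary _ (hu x)

theorem NPartiteSystem.localProduct_mem_unitary (S : NPartiteSystem N H) {d : ℕ}
    {u : S.LocalFamily d} (hu : ∀ x, u x ∈ unitary _) : S.localProduct u ∈ unitary _ := by
  refine list_prod_mem fun a ha => ?_
  obtain ⟨x, rfl⟩ := List.mem_ofFn.1 ha
  exact atParty_mem_unitary x (map_mem_unitary _ (hu x))

theorem IncreasingNet.Generates.map_localProduct {T : IncreasingNet ι N H}
    {S : NPartiteSystem N H} (h : T.Generates S) {n : ι} {d : ℕ}
    (u : (T.stage n).LocalFamily d) :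
    ((T.stage n).localProduct u).map (incl (h.joint_le n)) = S.localProduct (h.lift u) := by
  rw [NPartiteSystem.localProduct, list_prod_map, List.map_ofFn, NPartiteSystem.localProduct]
  refine congrArg (fun g => (List.ofFn g).prod) (funext fun x => ?_)
  rw [Function.comp_apply, atParty_map _ (map_zero (incl (h.joint_le n)))]
  rfl

/-- Restricting the state to a stage does not increase the error. -/
theorem IncreasingNet.Generates.embezzlingError_restrict_le {T : IncreasingNet ι N H}
    {S : NPartiteSystem N H} (h : T.Generates S) (ω : NormalState S.joint) {n : ι} {d : ℕ}
    (φ ψ : EuclideanSpace ℂ (Fin N → Fin d)) (u : (T.stage n).LocalFamily d) :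
    (T.stage n).embezzlingError (ω.restrict (h.joint_le n)) φ ψ u ≤
      S.embezzlingError ω φ ψ (h.lift u) := by
  have hval : ∀ a : Matrix (Fin N → Fin d) (Fin N → Fin d) (T.stage n).joint.toStarSubalgebra,
      (conjFunctional ((T.stage n).localProduct u)
        (tensorVectorState (ω.restrict (h.joint_le n)) φ) -
          tensorVectorState (ω.restrict (h.joint_le n)) ψ) a =
      (conjFunctional (S.localProduct (h.lift u)) (tensorVectorState ω φ) -
        tensorVectorState ω ψ) (a.map (incl (h.joint_le n))) := by
    intro a
    rw [LinearMap.sub_apply, LinearMap.sub_apply, conjFunctional_apply, conjFunctional_apply,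
      ← h.map_localProduct u, ← map_map_mul, ← star_map, ← map_map_mul]
    rfl
  exact functionalNorm_le_functionalNorm (h.joint_le n) hval

/-- The error depends continuously on the two vectors, uniformly in the local unitaries. -/
theorem NPartiteSystem.embezzlingError_le_add (S : NPartiteSystem N H) (ω : NormalState S.joint)
    {d : ℕ} (φ ψ φ' ψ' : EuclideanSpace ℂ (Fin N → Fin d)) {u : S.LocalFamily d}
    (hu : ∀ x, u x ∈ unitary _) :
    S.embezzlingError ω φ' ψ' u ≤ S.embezzlingError ω φ ψ u +
      (ENNReal.ofReal (∑ i, ∑ j, ‖star (φ' i) * φ' j - star (φ i) * φ j‖) +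
        ENNReal.ofReal (∑ i, ∑ j, ‖star (ψ i) * ψ j - star (ψ' i) * ψ' j‖)) := by
  have h : conjFunctional (S.localProduct u) (tensorVectorState ω φ') - tensorVectorState ω ψ' =
      (conjFunctional (S.localProduct u) (tensorVectorState ω φ) - tensorVectorState ω ψ) +
      (conjFunctional (S.localProduct u) (tensorVectorState ω φ' - tensorVectorState ω φ) +
        (tensorVectorState ω ψ - tensorVectorState ω ψ')) := by
    ext1 a
    simp only [LinearMap.sub_apply, LinearMap.add_apply, conjFunctional_apply]
    ring
  rw [NPartiteSystem.embezzlingError, h]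
  refine (functionalNorm_add_le _ _).trans (add_le_add le_rfl
    ((functionalNorm_add_le _ _).trans (add_le_add ?_ ?_)))
  · exact (functionalNorm_conjFunctional_le (S.localProduct_mem_unitary hu) _).trans
      (functionalNorm_tensorVectorState_sub_le ω φ' φ)
  · exact functionalNorm_tensorVectorState_sub_le ω ψ ψ'

/-- For fixed local unitaries the error is upper semicontinuous in the two vectors. -/
theorem NPartiteSystem.eventually_embezzlingError_lt (S : NPartiteSystem N H)
    (ω : NormalState S.joint) {d : ℕ}
    (p : EuclideanSpace ℂ (Fin N → Fin d) × EuclideanSpace ℂ (Fin N → Fin d))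
    {u : S.LocalFamily d} (hu : ∀ x, u x ∈ unitary _) {ε : ℝ≥0∞}
    (h : S.embezzlingError ω p.1 p.2 u < ε) :
    ∀ᶠ q in nhds p, S.embezzlingError ω q.1 q.2 u < ε := by
  have hc : Continuous fun q : EuclideanSpace ℂ (Fin N → Fin d) ×
      EuclideanSpace ℂ (Fin N → Fin d) => S.embezzlingError ω p.1 p.2 u +
      (ENNReal.ofReal (∑ i, ∑ j, ‖star (q.1 i) * q.1 j - star (p.1 i) * p.1 j‖) +
        ENNReal.ofReal (∑ i, ∑ j, ‖star (p.2 i) * p.2 j - star (q.2 i) * q.2 j‖)) := by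
    exact continuous_const.add ((ENNReal.continuous_ofReal.comp (by fun_prop)).add
      (ENNReal.continuous_ofReal.comp (by fun_prop)))
  have hlt := (hc.tendsto p).eventually_lt_const (by simpa using h)
  filter_upwards [hlt] with q hq
  exact (S.embezzlingError_le_add ω p.1 p.2 q.1 q.2 hu).trans_lt hq

variable [IsDirectedOrder ι] [Nonempty ι]

/-- Local unitaries of the generated system can be replaced by local unitaries of some stage with
an arbitrarily small change of the transformed state. -/
theorem IncreasingNet.Generates.exists_stage_unitary {T : IncreasingNet ι N H}
    {S : NPartiteSystem N H} (h : T.Generates S) (ω : NormalState S.joint) {d : ℕ}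
    {φ : EuclideanSpace ℂ (Fin N → Fin d)} (hφ : ‖φ‖ = 1) {u : S.LocalFamily d}
    (hu : ∀ x, u x ∈ unitary _) {ε : ℝ} (hε : 0 < ε) :
    ∃ n, ∃ w : (T.stage n).LocalFamily d, (∀ x, w x ∈ unitary _) ∧
      functionalNorm (conjFunctional (S.localProduct (h.lift w)) (tensorVectorState ω φ) -
        conjFunctional (S.localProduct u) (tensorVectorState ω φ)) < ENNReal.ofReal ε := by
  classical
  have hx : ∀ x, ∃ l : Filter (Matrix (Fin d) (Fin d) (S.party x).toStarSubalgebra), l.NeBot ∧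
      (∀ᶠ v in l, v ∈ unitary (Matrix (Fin d) (Fin d) (S.party x).toStarSubalgebra) ∧
        ∃ n, ∃ w ∈ unitary (Matrix (Fin d) (Fin d) ((T.stage n).party x).toStarSubalgebra),
          v = w.map (incl (h.party_le n x))) ∧
      EntrywiseTendsto l id (u x) := fun x =>
    exists_filter_entrywiseTendsto (M := fun n => (T.stage n).party x) (T.mono x) (h x)
      (fun n => h.party_le n x) (hu x)
  choose l hl hG hlim using hx
  let L : Filter (S.LocalFamily d) := Filter.pi l
  have hev : ∀ x, Filter.Tendsto (fun v : S.LocalFamily d => v x) L (l x) :=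
    fun x => Filter.tendsto_eval_pi l x
  have hu' : ∀ᶠ v in L, ∀ x, v x ∈ unitary _ :=
    Filter.eventually_all.2 fun x => (hev x).eventually ((hG x).mono fun v hv => hv.1)
  have hprod : EntrywiseTendsto L (fun v => S.localProduct v) (S.localProduct u) := by
    have := EntrywiseTendsto.list_prod (l := L) (List.finRange N)
      (fun x (v : S.LocalFamily d) => atParty x ((v x).map (incl (S.party_le_joint x))))
      (fun x => atParty x ((u x).map (incl (S.party_le_joint x)))) ?_ ?_
    · simpa only [NPartiteSystem.localProduct, List.ofFn_eq_map] using this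
    · intro x i j ξ
      by_cases hij : ∀ y, y ≠ x → i y = j y
      · simp only [atParty, Matrix.of_apply, if_pos hij]
        exact (hlim x (i x) (j x) ξ).comp (hev x)
      · simp only [atParty, Matrix.of_apply, if_neg hij]
        exact tendsto_const_nhds
    · intro x
      filter_upwards [hu'] with v hv
      exact atParty_mem_unitary x (map_mem_unitary _ (hv x))
  have hprodu : ∀ᶠ v in L, S.localProduct v ∈ unitary _ :=
    hu'.mono fun v hv => S.localProduct_mem_unitary hv
  have hf := tendsto_tensorVectorState_star_mul ω φ (S.localProduct_mem_unitary hu) hprodu hprod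
  have hf' := (((Complex.continuous_re.tendsto _).comp hf).sqrt).const_mul 2
  simp only [Complex.zero_re, Real.sqrt_zero, mul_zero] at hf'
  have hstage : ∀ᶠ v in L, ∀ x, ∃ n, ∃ w ∈ unitary (Matrix (Fin d) (Fin d)
      ((T.stage n).party x).toStarSubalgebra), v x = w.map (incl (h.party_le n x)) :=
    Filter.eventually_all.2 fun x => (hev x).eventually ((hG x).mono fun v hv => hv.2)
  obtain ⟨v, ⟨hv, hvu⟩, hvs⟩ := (((hf'.eventually_lt_const hε).and hu').and hstage).exists
  choose n w hw hvw using hvs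
  obtain ⟨k, hk⟩ := Finset.exists_le (Finset.univ.image n)
  have hk' : ∀ x, n x ≤ k := fun x => hk _ (Finset.mem_image_of_mem _ (Finset.mem_univ x))
  let w' : (T.stage k).LocalFamily d := fun x => (w x).map (incl (T.mono x (hk' x)))
  have hw' : h.lift w' = v := funext fun x => (hvw x).symm
  refine ⟨k, w', fun x => map_mem_unitary _ (hw x), ?_⟩
  rw [hw']
  refine (functionalNorm_conjFunctional_sub_le _ (tensorVectorState_nonneg ω φ) ?_
    (S.localProduct_mem_unitary hu) (S.localProduct_mem_unitary hvu)).trans_lt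
    ((ENNReal.ofReal_lt_ofReal_iff hε).2 hv)
  rw [tensorVectorState_one, hφ]
  simp

/-- By compactness of the unit sphere, one stage provides the unitaries for all pairs of pure
states. -/
theorem IncreasingNet.Generates.exists_uniform_stage {T : IncreasingNet ι N H}
    {S : NPartiteSystem N H} (h : T.Generates S) (ω : NormalState S.joint)
    (hω : S.IsEmbezzling ω) (d : ℕ) {ε : ℝ} (hε : 0 < ε) :
    ∃ n, ∀ ψ φ : EuclideanSpace ℂ (Fin N → Fin d), ‖ψ‖ = 1 → ‖φ‖ = 1 →
      ∃ u : (T.stage n).LocalFamily d, (∀ x, u x ∈ unitary _) ∧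
        S.embezzlingError ω φ ψ (h.lift u) < ENNReal.ofReal ε := by
  let E := EuclideanSpace ℂ (Fin N → Fin d)
  let good : ι → E × E → Prop := fun n p => ∃ u : (T.stage n).LocalFamily d,
    (∀ x, u x ∈ unitary _) ∧ S.embezzlingError ω p.1 p.2 (h.lift u) < ENNReal.ofReal ε
  have hmono : ∀ {n m}, n ≤ m → ∀ p, good n p → good m p := by
    rintro n m hnm p ⟨u, hu, hlt⟩
    exact ⟨T.transport hnm u, T.transport_mem_unitary hnm hu, hlt⟩
  have hK : IsCompact (Metric.sphere (0 : E) 1 ×ˢ Metric.sphere (0 : E) 1) :=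
    (isCompact_sphere _ _).prod (isCompact_sphere _ _)
  have key : ∃ n, ∀ p ∈ Metric.sphere (0 : E) 1 ×ˢ Metric.sphere (0 : E) 1, good n p := by
    refine hK.induction_on (p := fun s => ∃ n, ∀ p ∈ s, good n p) ?_ ?_ ?_ ?_
    · exact ⟨Classical.arbitrary ι, by simp⟩
    · rintro s t hst ⟨n, hn⟩
      exact ⟨n, fun p hp => hn p (hst hp)⟩
    · rintro s t ⟨n, hn⟩ ⟨m, hm⟩
      obtain ⟨k, hnk, hmk⟩ := exists_ge_ge n m
      exact ⟨k, fun p hp => hp.elim (fun hp => hmono hnk p (hn p hp))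
        fun hp => hmono hmk p (hm p hp)⟩
    · rintro p ⟨hp1, hp2⟩
      rw [mem_sphere_zero_iff_norm] at hp1 hp2
      obtain ⟨u, hu, hlt⟩ := hω d p.2 p.1 hp2 hp1 (ε / 2) (by positivity)
      obtain ⟨n, w, hw, hlt'⟩ := h.exists_stage_unitary ω hp1 hu (half_pos hε)
      have hsum : S.embezzlingError ω p.1 p.2 (h.lift w) < ENNReal.ofReal ε := by
        have h1 := functionalNorm_add_le
          (conjFunctional (S.localProduct (h.lift w)) (tensorVectorState ω p.1) -
            conjFunctional (S.localProduct u) (tensorVectorState ω p.1))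
          (conjFunctional (S.localProduct u) (tensorVectorState ω p.1) - tensorVectorState ω p.2)
        rw [sub_add_sub_cancel] at h1
        refine h1.trans_lt ((ENNReal.add_lt_add hlt' hlt).trans_eq ?_)
        rw [← ENNReal.ofReal_add (by positivity) (by positivity), add_halves]
      exact ⟨_, mem_nhdsWithin_of_mem_nhds
        (S.eventually_embezzlingError_lt ω p (h.lift_mem_unitary hw) hsum),
        n, fun q hq => ⟨w, hw, hq⟩⟩
  obtain ⟨n, hn⟩ := key
  exact ⟨n, fun ψ φ hψ hφ => hn (φ, ψ)
    ⟨mem_sphere_zero_iff_norm.2 hφ, mem_sphere_zero_iff_norm.2 hψ⟩⟩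

theorem NormalState.restrict_restrict {A B C : VonNeumannAlgebra H} (hAB : A ≤ B) (hBC : B ≤ C)
    (hAC : A ≤ C) (ω : NormalState C) : (ω.restrict hBC).restrict hAB = ω.restrict hAC := rfl

end Net

end Embezzlement

theorem mainTheorem2 {H : Type*} [NormedAddCommGroup H] [InnerProductSpace ℂ H] [CompleteSpace H]
    {ι : Type*} [Preorder ι] [IsDirectedOrder ι] [Nonempty ι] {N : ℕ}
    (S : Embezzlement.NPartiteSystem N H) (T : Embezzlement.IncreasingNet ι N H)
    (hgen : T.Generates S) (ω : Embezzlement.NormalState S.joint) (hω : S.IsEmbezzling ω) :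
    T.IsConsistentEmbezzlingFamily fun n => ω.restrict (hgen.joint_le n) := by
  refine ⟨⟨fun d ε hε => ?_, fun d ε hε => ?_⟩, fun n m hnm => ?_⟩
  · obtain ⟨n, hn⟩ := hgen.exists_uniform_stage ω hω d hε
    refine ⟨n, fun m hnm ψ φ hψ hφ => ?_⟩
    obtain ⟨u, hu, hlt⟩ := hn ψ φ hψ hφ
    refine ⟨T.transport hnm u, T.transport_mem_unitary hnm hu, ?_⟩
    refine (hgen.embezzlingError_restrict_le ω φ ψ (T.transport hnm u)).trans_lt ?_
    rw [hgen.lift_transport hnm]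
    exact hlt
  · obtain ⟨n, hn⟩ := hgen.exists_uniform_stage ω hω d hε
    refine ⟨n, fun ψ φ hψ hφ => ?_⟩
    obtain ⟨u, hu, hlt⟩ := hn ψ φ hψ hφ
    refine ⟨u, hu, fun m hnm => ?_⟩
    refine (hgen.embezzlingError_restrict_le ω φ ψ (T.transport hnm u)).trans_lt ?_
    rw [hgen.lift_transport hnm]
    exact hlt
  · exact (ω.restrict_restrict _ _ _).symm
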